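/- \textbf{Setting.} Let $\Omega$ be a separable metric space with its Borel $\sigma$-algebra $\mathcal F$, let $\tau\colon\mathbb R\times\Omega\to\Omega$, $(a,\omega)\mapsto\tau_a\omega$, be a continuous action of $\mathbb R$, and let $\mathbb P$ be a probability measure on $(\Omega,\mathcal F)$ such that (i) $\mathbb P(U)>0$ for every nonempty open $U$; (ii) $\mathbb P(\tau_aA)=\mathbb P(A)$ for all $a\in\mathbb R$ and $A\in\mathcal F$; (iii) if $A\in\mathcal F$ satisfies $\tau_aA=A$ for all $a\in\mathbb R$, then $\mathbb P(A)\in\{0,1\}$. Let $\bar K\colon\Omega\times[-1,1]^2\to\mathbb R$ be measurable and put $K(q,p;\omega):=\bar K(\tau_q\omega,p)$ for $q\in\mathbb R$, $p=(p_1,p_2)\in[-1,1]^2$. Assume that for $\mathbb P$-almost every $\omega$ the function $K(\cdot,\cdot;\omega)$ is $C^1$ on $\mathbb R\times[-1,1]^2$ up to the boundary, and that its gradient points inward on the boundary, i.e. for $i=1,2$: $\partial_{p_i}K<0$ wherever $p_i=1$, and $\partial_{p_i}K>0$ wherever $p_i=-1$. A critical point of $K(\cdot,\cdot;\omega)$ is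 a point of $\mathbb R\times[-1,1]^2$ at which its gradient (with respect to $(q,p_1,p_2)$) vanishes; a saddle point is a critical point that is neither a local maximum nor a local minimum. We say that there is a continuum of critical points if the set of critical points has the cardinality of $\mathbb R$. \textbf{Theorem.} (a) For $\mathbb P$-almost every $\omega$, $K(\cdot,\cdot;\omega)$ has infinitely many critical points. (b) One of the following holds: (1) for $\mathbb P$-almost every $\omega$, $K(\cdot,\cdot;\omega)$ has a continuum of critical points; or (2) for $\mathbb P$-almost every $\omega$, $K(\cdot,\cdot;\omega)$ has infinitely many critical points that are local maxima, and infinitely many critical points that are saddle points or local minima. -/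

import Mathlib

open MeasureTheory Set

/-- `P` is a `τ`-invariant ergodic probability measure for the continuous action `τ` of `ℝ` on `Ω`:
it charges every nonempty open set, it is preserved by every `τ_a`, and every measurable set that is
mapped onto itself by all the `τ_a` has probability `0` or `1`. -/
structure IsInvariantErgodicProb {Ω : Type*} [TopologicalSpace Ω] [MeasurableSpace Ω]
    (τ : Flow ℝ Ω) (P : Measure Ω) : Prop where
  prob : IsProbabilityMeasure P
  pos_of_open : ∀ U : Set Ω, IsOpen U → U.Nonempty → 0 < P U
  preserving : ∀ (a : ℝ) (A : Set Ω), MeasurableSet A → P (τ a '' A) = P A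
  ergodic : ∀ A : Set Ω, MeasurableSet A → (∀ a : ℝ, τ a '' A = A) → P A = 1 ∨ P A = 0

/-- The closed slab `ℝ × [-1,1]²`, as the set of the points `x = (q, p₁, p₂)` of Euclidean
`3`-space with `p₁, p₂ ∈ [-1,1]`. -/
def slab : Set (EuclideanSpace ℝ (Fin 3)) :=
  {x | x 1 ∈ Icc (-1 : ℝ) 1 ∧ x 2 ∈ Icc (-1 : ℝ) 1}

/-- The random function `K(q, p; ω) = K̄(τ_q ω, p)`. Only its values for `(q, p)` in the slab, that
is, the values of `K̄` on `Ω × [-1,1]²`, are ever used. -/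
def stationaryFun {Ω : Type*} [TopologicalSpace Ω] (τ : Flow ℝ Ω) (Kbar : Ω → ℝ → ℝ → ℝ)
    (ω : Ω) (x : EuclideanSpace ℝ (Fin 3)) : ℝ :=
  Kbar (τ (x 0) ω) (x 1) (x 2)

/-- The gradient of `f` over the slab (one-sided at the boundary). -/
noncomputable def slabGrad (f : EuclideanSpace ℝ (Fin 3) → ℝ) (x : EuclideanSpace ℝ (Fin 3)) :
    EuclideanSpace ℝ (Fin 3) :=
  gradientWithin f slab x

/-- The gradient of `f` points (strictly) inward on the boundary of the slab: on each of the four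
faces `p_i = ±1` its component along the outer normal is negative. On an edge of the slab this is
required for both faces that meet there. -/
def GradPointsInward (f : EuclideanSpace ℝ (Fin 3) → ℝ) : Prop :=
  ∀ x ∈ slab,
    (x 1 = 1 → slabGrad f x 1 < 0) ∧ (x 1 = -1 → 0 < slabGrad f x 1) ∧
    (x 2 = 1 → slabGrad f x 2 < 0) ∧ (x 2 = -1 → 0 < slabGrad f x 2)

/-- The set of critical points of `f` in the slab. -/
def critPts (f : EuclideanSpace ℝ (Fin 3) → ℝ) : Set (EuclideanSpace ℝ (Fin 3)) :=
  {x | x ∈ slab ∧ slabGrad f x = 0}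

/-- The critical points of `f` that are local maxima. -/
def localMaxPts (f : EuclideanSpace ℝ (Fin 3) → ℝ) : Set (EuclideanSpace ℝ (Fin 3)) :=
  {x | x ∈ critPts f ∧ IsLocalMaxOn f slab x}

/-- The critical points of `f` that are local minima. -/
def localMinPts (f : EuclideanSpace ℝ (Fin 3) → ℝ) : Set (EuclideanSpace ℝ (Fin 3)) :=
  {x | x ∈ critPts f ∧ IsLocalMinOn f slab x}

/-- The saddle points of `f`: critical points that are neither local maxima nor local minima. -/
def saddlePts (f : EuclideanSpace ℝ (Fin 3) → ℝ) : Set (EuclideanSpace ℝ (Fin 3)) :=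
  {x | x ∈ critPts f ∧ ¬ IsLocalMaxOn f slab x ∧ ¬ IsLocalMinOn f slab x}

/-- A continuum of critical points: the set of critical points has the cardinality of `ℝ`. -/
def HasContinuumOfCritPts (f : EuclideanSpace ℝ (Fin 3) → ℝ) : Prop :=
  Cardinal.mk (critPts f) = Cardinal.continuum

/-!
Whether some slice `{q} × [-1,1]²` of the slab carries no critical point is a `τ`-invariant event,
so by ergodicity it is almost sure or almost impossible. If every slice carries a critical point,
there is a continuum of them.

Otherwise take a slice without critical points. A neighbourhood of it is a zone where `|∇f| ≥ δ` and
`m ≤ f ≤ M`; as the maximum of `f` on the slice is not critical and the gradient points inward, one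
can arrange that `f > M` at some point, a peak. By Poincaré recurrence zones and peaks alternate up
to `q = ∞`, and between two zones surrounding a peak there is a local maximum.

Suppose that all critical points beyond some `q = R` were local maxima. Start with the component
of `{f > M}` around a peak and lower the level `c` until the component of `{f > c}` first reaches
an end of a long window; until then it is confined, and by the mountain pass principle neither it
nor its superlevel sets can change by a jump. Hence the sets `{f > d}`, `d ≥ c`, are connected
inside the component, so the maximum `φ(q)` of `f` over the slices of the component is a
quasiconcave function, and it is monotone through at least `N` consecutive zones. At a maximum
over a slice the gradient is horizontal, so `φ` changes at rate at least `δ / 2` in each of these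
zones; but `m ≤ φ ≤ M` there, which is absurd for large `N`.
-/

open Filter Topology

section Superlevel

variable {X : Type*} [TopologicalSpace X] {f : X → ℝ} {c d : ℝ} {x y z : X}

/-- The connected component of `x` in the strict superlevel set `{f > c}`, empty if `f x ≤ c`. -/
def superlevelComponent (f : X → ℝ) (c : ℝ) (x : X) : Set X :=
  connectedComponentIn {y | c < f y} x

theorem lt_of_mem_superlevelComponent (hy : y ∈ superlevelComponent f c x) : c < f y :=
  connectedComponentIn_subset {z | c < f z} x hy

theorem mem_superlevelComponent_self (hx : c < f x) : x ∈ superlevelComponent f c x :=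
  mem_connectedComponentIn hx

theorem isPreconnected_superlevelComponent : IsPreconnected (superlevelComponent f c x) :=
  isPreconnected_connectedComponentIn

theorem superlevelComponent_subset_of_le (hcd : c ≤ d) :
    superlevelComponent f d x ⊆ superlevelComponent f c x :=
  connectedComponentIn_mono x fun _ hy => hcd.trans_lt hy

theorem superlevelComponent_eq (hy : y ∈ superlevelComponent f c x) :
    superlevelComponent f c x = superlevelComponent f c y :=
  connectedComponentIn_eq hy

theorem subset_superlevelComponent {s : Set X} (hs : IsPreconnected s)
    (hsf : ∀ y ∈ s, c < f y) (hz : z ∈ s) (hzx : z ∈ superlevelComponent f c x) :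
    s ⊆ superlevelComponent f c x := by
  rw [superlevelComponent_eq hzx]
  exact hs.subset_connectedComponentIn hz hsf

theorem superlevelComponent_subset_of_frontier_le {O : Set X} (hO : IsOpen O) (hx : x ∈ O)
    (hfr : ∀ y ∈ frontier O, f y ≤ c) : superlevelComponent f c x ⊆ O := by
  rcases (superlevelComponent f c x).eq_empty_or_nonempty with he | hne
  · simp [he]
  have hxc : x ∈ superlevelComponent f c x :=
    mem_connectedComponentIn (connectedComponentIn_nonempty_iff.1 hne)
  refine isPreconnected_superlevelComponent.subset_left_of_subset_union hO
    (isClosed_closure (s := O)).isOpen_compl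
    (disjoint_compl_right_iff_subset.2 subset_closure) (fun y hy => ?_) ⟨x, hxc, hx⟩
  by_contra! hyO
  rw [mem_union, not_or, notMem_compl_iff] at hyO
  have hyfr : y ∈ frontier O := ⟨hyO.2, hO.interior_eq.symm ▸ hyO.1⟩
  exact (hfr y hyfr).not_gt (lt_of_mem_superlevelComponent hy)

theorem le_of_mem_closure_superlevelComponent (hf : Continuous f)
    (hy : y ∈ closure (superlevelComponent f c x)) : c ≤ f y :=
  closure_minimal (fun _ hz => (lt_of_mem_superlevelComponent hz).le)
    (isClosed_le continuous_const hf) hy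

/-- A regularity condition, weaker than being noncritical, under which superlevel sets do not
change their topology at `y`: near `y`, the set `{f > f y}` is connected and its closure is
`{f ≥ f y}`. -/
def IsRegularFromAbove (f : X → ℝ) (y : X) : Prop :=
  ∃ U ∈ 𝓝 y, IsPreconnected (U ∩ {z | f y < f z}) ∧
    U ∩ {z | f y ≤ f z} ⊆ closure (U ∩ {z | f y < f z})

theorem isRegularFromAbove_of_nhdsWithin {S U : Set X} {x : S} (hU : U ∈ 𝓝[S] (x : X)) (hUS : U ⊆ S)
    (hconn : IsPreconnected (U ∩ {z | f x < f z}))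
    (hcl : U ∩ {z | f x ≤ f z} ⊆ closure (U ∩ {z | f x < f z})) :
    IsRegularFromAbove (fun z : S => f z) x := by
  have himage : Subtype.val '' (Subtype.val ⁻¹' U ∩ {z : S | f x < f z}) = U ∩ {z | f x < f z} :=
    subset_antisymm (by rintro _ ⟨z, hz, rfl⟩; exact hz) fun z hz => ⟨⟨z, hUS hz.1⟩, hz, rfl⟩
  refine ⟨Subtype.val ⁻¹' U, preimage_coe_mem_nhds_subtype.2 hU, ?_, fun z hz => ?_⟩
  · rwa [← IsInducing.subtypeVal.isPreconnected_image, himage]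
  · rw [closure_subtype, himage]
    exact hcl hz

variable [LocallyConnectedSpace X]

theorem isOpen_superlevelComponent (hf : Continuous f) : IsOpen (superlevelComponent f c x) :=
  (isOpen_lt continuous_const hf).connectedComponentIn

theorem mem_superlevelComponent_of_mem_closure (hf : Continuous f)
    (hy : y ∈ closure (superlevelComponent f c x)) (hcy : c < f y) :
    y ∈ superlevelComponent f c x := by
  obtain ⟨z, hzy, hzx⟩ := mem_closure_iff.1 hy _ (isOpen_superlevelComponent hf)
    (mem_superlevelComponent_self hcy)
  rw [superlevelComponent_eq hzx, ← superlevelComponent_eq hzy]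
  exact mem_superlevelComponent_self hcy

theorem exists_gt_mem_superlevelComponent (hf : Continuous f)
    (hz : z ∈ superlevelComponent f c y) : ∃ d > c, z ∈ superlevelComponent f d y := by
  have hcy : y ∈ {w | c < f w} := connectedComponentIn_nonempty_iff.1 ⟨z, hz⟩
  refine isPreconnected_superlevelComponent.induction₂'
    (fun y z => ∃ d > c, z ∈ superlevelComponent f d y) (fun w hw => ?_) ?_
    (mem_superlevelComponent_self hcy) hz
  · obtain ⟨d, hcd, hdw⟩ := exists_between (lt_of_mem_superlevelComponent hw)
    have hnhds : superlevelComponent f d w ∈ 𝓝 w :=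
      (isOpen_superlevelComponent hf).mem_nhds (mem_superlevelComponent_self hdw)
    filter_upwards [mem_nhdsWithin_of_mem_nhds hnhds] with v hv
    exact ⟨⟨d, hcd, hv⟩, ⟨d, hcd, superlevelComponent_eq hv ▸ mem_superlevelComponent_self hdw⟩⟩
  · rintro u v w - - - ⟨d, hcd, hv⟩ ⟨e, hce, hw⟩
    refine ⟨min d e, lt_min hcd hce, ?_⟩
    rw [superlevelComponent_eq (superlevelComponent_subset_of_le (min_le_left d e) hv)]
    exact superlevelComponent_subset_of_le (min_le_right d e) hw

theorem eventually_mem_closure_superlevelComponent (hf : Continuous f)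
    (hy : y ∈ closure (superlevelComponent f c x))
    (hreg : ¬IsLocalMax f y → IsRegularFromAbove f y) :
    ∀ᶠ z in 𝓝 y, c ≤ f z → z ∈ closure (superlevelComponent f c x) := by
  rcases (le_of_mem_closure_superlevelComponent hf hy).eq_or_lt with rfl | hlt
  · have hnot_max : ¬IsLocalMax f y := fun hmax => by
      obtain ⟨z, hzx, hzy⟩ := ((mem_closure_iff_frequently.1 hy).and_eventually hmax).exists
      exact hzy.not_gt (lt_of_mem_superlevelComponent hzx)
    obtain ⟨U, hU, hUconn, hUcl⟩ := hreg hnot_max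
    obtain ⟨z, hzx, hzU⟩ := ((mem_closure_iff_frequently.1 hy).and_eventually hU).exists
    have hsub : U ∩ {z | f y < f z} ⊆ superlevelComponent f (f y) x :=
      subset_superlevelComponent hUconn (fun w hw => hw.2)
        ⟨hzU, lt_of_mem_superlevelComponent hzx⟩ hzx
    filter_upwards [hU] with w hwU hw using closure_mono hsub (hUcl ⟨hwU, hw⟩)
  · have hnhds : superlevelComponent f c x ∈ 𝓝 y :=
      (isOpen_superlevelComponent hf).mem_nhds (mem_superlevelComponent_of_mem_closure hf hy hlt)
    filter_upwards [hnhds] with z hz _ using subset_closure hz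

variable [LocallyCompactSpace X] [T2Space X]

theorem exists_isOpen_between_frontier_lt (hf : Continuous f)
    (hK : IsCompact (closure (superlevelComponent f c x)))
    (hreg : ∀ y ∈ closure (superlevelComponent f c x),
      ¬IsLocalMax f y → IsRegularFromAbove f y)
    {W : Set X} (hW : IsOpen W) (hKW : closure (superlevelComponent f c x) ⊆ W) :
    ∃ O, IsOpen O ∧ closure (superlevelComponent f c x) ⊆ O ∧ O ⊆ W ∧ IsCompact (closure O) ∧
      ∀ y ∈ frontier O, f y < c := by
  set C := closure (superlevelComponent f c x)
  have hCV : C ⊆ interior {z | c ≤ f z → z ∈ C} := fun y hy => mem_interior_iff_mem_nhds.2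
    (eventually_mem_closure_superlevelComponent hf hy (hreg y hy))
  obtain ⟨O, hO, hCO, hOV, hOc⟩ := exists_open_between_and_isCompact_closure hK
    (isOpen_interior.inter hW) (subset_inter hCV hKW)
  refine ⟨O, hO, hCO, fun y hy => (hOV (subset_closure hy)).2, hOc, fun y hy => ?_⟩
  by_contra! hcy
  have hyC : y ∈ C := interior_subset (hOV (frontier_subset_closure hy)).1 hcy
  rw [hO.frontier_eq] at hy
  exact hy.2 (hCO hyC)

theorem exists_superlevelComponent_subset (hf : Continuous f) (hx : c < f x)
    (hK : IsCompact (closure (superlevelComponent f c x)))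
    (hreg : ∀ y ∈ closure (superlevelComponent f c x),
      ¬IsLocalMax f y → IsRegularFromAbove f y)
    {W : Set X} (hW : IsOpen W) (hKW : closure (superlevelComponent f c x) ⊆ W) :
    ∃ d < c, superlevelComponent f d x ⊆ W := by
  obtain ⟨O, hO, hCO, hOW, hOc, hfr⟩ := exists_isOpen_between_frontier_lt hf hK hreg hW hKW
  obtain ⟨d, hdc, hd⟩ : ∃ d < c, ∀ y ∈ frontier O, f y ≤ d := by
    rcases (frontier O).eq_empty_or_nonempty with he | hne
    · exact ⟨c - 1, by linarith, by simp [he]⟩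
    · obtain ⟨y, hy, hmax⟩ := (hOc.of_isClosed_subset isClosed_frontier
        frontier_subset_closure).exists_isMaxOn hne hf.continuousOn
      exact ⟨f y, hfr y hy, hmax⟩
  have hxO : x ∈ O := hCO (subset_closure (mem_superlevelComponent_self hx))
  exact ⟨d, hdc, (superlevelComponent_subset_of_frontier_le hO hxO hd).trans hOW⟩

/-- As the level rises from `c` to `d`, the component of `y` could lose `z` only by a jump at the
infimum `e` of the levels that separate `y` from `z`, which the mountain pass principle excludes. -/
theorem mem_superlevelComponent_of_lt (hf : Continuous f)
    (hK : IsCompact (closure (superlevelComponent f c x)))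
    (hreg : ∀ y ∈ closure (superlevelComponent f c x),
      ¬IsLocalMax f y → IsRegularFromAbove f y)
    (hcd : c ≤ d) (hy : y ∈ superlevelComponent f c x) (hz : z ∈ superlevelComponent f c x)
    (hyd : d < f y) (hzd : d < f z) : z ∈ superlevelComponent f d y := by
  rw [superlevelComponent_eq hy] at hz hK hreg
  by_contra hdz
  let J : Set ℝ := {e | c ≤ e ∧ z ∉ superlevelComponent f e y}
  have hdJ : d ∈ J := ⟨hcd, hdz⟩
  have hJ : BddBelow J := ⟨c, fun e he => he.1⟩
  set e := sInf J
  have hed : e ≤ d := csInf_le hJ hdJ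
  have hce : c ≤ e := le_csInf ⟨d, hdJ⟩ fun _ h => h.1
  have hze : z ∉ superlevelComponent f e y := fun hze => by
    obtain ⟨e', hee', hze'⟩ := exists_gt_mem_superlevelComponent hf hze
    obtain ⟨a, haJ, hae'⟩ := exists_lt_of_csInf_lt ⟨d, hdJ⟩ hee'
    exact haJ.2 (superlevelComponent_subset_of_le hae'.le hze')
  have hsub : closure (superlevelComponent f e y) ⊆ closure (superlevelComponent f c y) :=
    closure_mono (superlevelComponent_subset_of_le hce)
  obtain ⟨b, hbe, hzb⟩ := exists_superlevelComponent_subset hf (hed.trans_lt hyd)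
    (hK.of_isClosed_subset isClosed_closure hsub) (fun w hw => hreg w (hsub hw))
    (isOpen_compl_singleton (x := z)) (subset_compl_singleton_iff.2 fun hz' =>
      hze (mem_superlevelComponent_of_mem_closure hf hz' (hed.trans_lt hzd)))
  have hzb' : z ∉ superlevelComponent f (max b c) y := fun h =>
    hzb (superlevelComponent_subset_of_le (le_max_left b c) h) rfl
  have hce' : c < e := hce.lt_of_ne fun h => hze (h ▸ hz)
  exact (csInf_le hJ ⟨le_max_right b c, hzb'⟩).not_gt (max_lt hbe hce')

end Superlevel

section OneDim

variable {φ : ℝ → ℝ} {a b κ ℓ : ℝ}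

/-- From `t`, the function `φ` rises at rate at least `κ` to the right (`σ = 1`) or to the left
(`σ = -1`). -/
def RisesFrom (φ : ℝ → ℝ) (κ t : ℝ) : Prop :=
  ∃ σ : ℝ, (σ = 1 ∨ σ = -1) ∧ ∀ᶠ s in 𝓝[>] (0 : ℝ), φ t + κ * s ≤ φ (t + σ * s)

theorem RisesFrom.comp_neg {t : ℝ} (h : RisesFrom φ κ (-t)) : RisesFrom (fun t => φ (-t)) κ t := by
  obtain ⟨σ, hσ, hs⟩ := h
  refine ⟨-σ, hσ.symm.imp (fun h => by simp [h]) (fun h => by simp [h]), ?_⟩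
  filter_upwards [hs] with s hs
  rwa [show -(t + -σ * s) = -t + σ * s by ring]

theorem RisesFrom.exists_gt_of_monotoneOn {t : ℝ} (h : RisesFrom φ κ t)
    (hφ : MonotoneOn φ (Icc a b)) (hκ : 0 < κ) (ht : t ∈ Ioo a b) :
    ∃ u ∈ Ioo t b, φ t + κ * (u - t) ≤ φ u := by
  obtain ⟨σ, hσ, hs⟩ := h
  have hsmall : ∀ᶠ s in 𝓝[>] (0 : ℝ), s ∈ Ioo 0 (min (t - a) (b - t)) :=
    Ioo_mem_nhdsGT (lt_min (sub_pos.2 ht.1) (sub_pos.2 ht.2))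
  obtain ⟨s, hφs, hs0, hsab⟩ := (hs.and hsmall).exists
  obtain ⟨hsa, hsb⟩ := lt_min_iff.1 hsab
  rcases hσ with rfl | rfl
  · refine ⟨t + s, ⟨by linarith, by linarith⟩, ?_⟩
    simpa using hφs
  · have hle : φ (t + -1 * s) ≤ φ t :=
      hφ ⟨by linarith, by linarith [ht.2]⟩ (Ioo_subset_Icc_self ht) (by linarith)
    linarith [mul_pos hκ hs0]

theorem add_mul_sub_le_of_forall_exists_gt (hab : a ≤ b) (hκ : 0 < κ)
    (hφ : MonotoneOn φ (Icc a b))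
    (h : ∀ t ∈ Ico a b, ∃ u ∈ Ioc t b, φ t + κ * (u - t) ≤ φ u) :
    φ a + κ * (b - a) ≤ φ b := by
  let T : Set ℝ := {t | t ∈ Icc a b ∧ φ a + κ * (t - a) ≤ φ t}
  have hT : BddAbove T := ⟨b, fun t ht => ht.1.2⟩
  have haT : a ∈ T := ⟨left_mem_Icc.2 hab, by simp⟩
  set m := sSup T
  have ham : a ≤ m := le_csSup hT haT
  have hmb : m ≤ b := csSup_le ⟨a, haT⟩ fun t ht => ht.1.2
  have hm : φ a + κ * (m - a) ≤ φ m := by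
    have hle : m ≤ a + (φ m - φ a) / κ := csSup_le ⟨a, haT⟩ fun t ht => by
      have htm : φ t ≤ φ m := hφ ht.1 ⟨ham, hmb⟩ (le_csSup hT ht)
      have : t - a ≤ (φ m - φ a) / κ := (le_div_iff₀' hκ).2 (by linarith [ht.2])
      linarith
    have : κ * (m - a) ≤ φ m - φ a := (le_div_iff₀' hκ).1 (by linarith)
    linarith
  rcases hmb.eq_or_lt with hmb | hmb
  · rwa [hmb] at hm
  · obtain ⟨u, hu, hφu⟩ := h m ⟨ham, hmb⟩
    have huT : u ∈ T := ⟨⟨ham.trans hu.1.le, hu.2⟩, by linarith⟩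
    exact absurd (le_csSup hT huT) hu.1.not_ge

theorem add_mul_sub_le_of_monotoneOn_of_risesFrom (hab : a ≤ b) (hκ : 0 < κ)
    (hφ : MonotoneOn φ (Icc a b)) (h : ∀ t ∈ Ioo a b, RisesFrom φ κ t) :
    φ a + κ * (b - a) ≤ φ b := by
  rcases hab.eq_or_lt with rfl | hlt
  · simp
  have hinner : ∀ᶠ t in 𝓝[>] a, φ a + κ * (b - t) ≤ φ b := by
    filter_upwards [Ioo_mem_nhdsGT hlt] with t ht
    have hφt : φ t + κ * (b - t) ≤ φ b :=
      add_mul_sub_le_of_forall_exists_gt ht.2.le hκ (hφ.mono (Icc_subset_Icc_left ht.1.le))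
        fun u hu => by
          have huab : u ∈ Ioo a b := ⟨ht.1.trans_le hu.1, hu.2⟩
          obtain ⟨v, hv, hφv⟩ := (h u huab).exists_gt_of_monotoneOn hφ hκ huab
          exact ⟨v, ⟨hv.1, hv.2.le⟩, hφv⟩
    linarith [hφ (left_mem_Icc.2 hab) (Ioo_subset_Icc_self ht) ht.1.le]
  have hcont : Continuous fun t => φ a + κ * (b - t) := by fun_prop
  exact le_of_tendsto (hcont.tendsto a |>.mono_left nhdsWithin_le_nhds) hinner

theorem add_mul_sub_le_of_antitoneOn_of_risesFrom (hab : a ≤ b) (hκ : 0 < κ)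
    (hφ : AntitoneOn φ (Icc a b)) (h : ∀ t ∈ Ioo a b, RisesFrom φ κ t) :
    φ b + κ * (b - a) ≤ φ a := by
  have hneg := add_mul_sub_le_of_monotoneOn_of_risesFrom (φ := fun t => φ (-t))
    (neg_le_neg hab) hκ
    (fun s hs t ht hst => hφ ⟨le_neg.1 ht.2, neg_le.1 ht.1⟩ ⟨le_neg.1 hs.2, neg_le.1 hs.1⟩
      (neg_le_neg hst))
    (fun t ht => RisesFrom.comp_neg (h (-t) ⟨lt_neg.1 ht.2, neg_lt.1 ht.1⟩))
  simpa only [neg_neg, sub_neg_eq_add, neg_add_eq_sub] using hneg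

theorem antitoneOn_or_monotoneOn_of_quasiconcaveOn {S : Set ℝ} (hφ : QuasiconcaveOn ℝ S φ)
    (t : ℝ) : AntitoneOn φ (S ∩ Ici t) ∨ MonotoneOn φ (S ∩ Iic t) := by
  have hmin : ∀ x ∈ S, ∀ z ∈ S, ∀ y ∈ Icc x z, min (φ x) (φ z) ≤ φ y := fun x hx z hz y hy =>
    ((hφ (min (φ x) (φ z))).ordConnected.out ⟨hx, min_le_left _ _⟩ ⟨hz, min_le_right _ _⟩ hy).2
  by_contra! ⟨hanti, hmono⟩
  simp only [AntitoneOn, MonotoneOn, not_forall, not_le] at hanti hmono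
  obtain ⟨x, hx, y, hy, hxy, hφxy⟩ := hanti
  obtain ⟨u, hu, w, hw, huw, hφwu⟩ := hmono
  have hwx : w ≤ x := le_trans hw.2 hx.2
  rcases le_or_gt (φ w) (φ x) with h | h
  · rcases min_le_iff.1 (hmin u hu.1 y hy.1 w ⟨huw, hwx.trans hxy⟩) with h' | h' <;> linarith
  · rcases min_le_iff.1 (hmin u hu.1 y hy.1 x ⟨huw.trans hwx, hxy⟩) with h' | h' <;> linarith

theorem add_mul_le_of_forall_add_le {u : ℕ → ℝ} {e : ℝ} {N : ℕ}
    (h : ∀ k < N, u k + e ≤ u (k + 1)) : u 0 + N * e ≤ u N := by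
  induction N with
  | zero => simp
  | succ N ih =>
    have hN := ih fun k hk => h k (hk.trans N.lt_succ_self)
    push_cast
    linarith [h N N.lt_succ_self]

theorem mul_le_sub_of_quasiconcaveOn_of_risesFrom {S : Set ℝ} (hφ : QuasiconcaveOn ℝ S φ)
    (hκ : 0 < κ) (hℓ : 0 ≤ ℓ) {α : ℕ → ℝ} (hα : ∀ k, α k + ℓ ≤ α (k + 1)) {N : ℕ}
    (hS₀ : α 0 ∈ S) (hS : α (2 * N) ∈ S) {m M : ℝ} (hmM : ∀ k ≤ 2 * N, φ (α k) ∈ Icc m M)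
    (hrise : ∀ k < 2 * N, ∀ t ∈ Ioo (α k) (α k + ℓ), RisesFrom φ κ t) :
    N * (κ * ℓ) ≤ M - m := by
  have hmono : Monotone α := monotone_nat_of_le_succ fun k => by linarith [hα k]
  have hαS : ∀ i j, j ≤ 2 * N → Icc (α i) (α j) ⊆ S := fun i j hj =>
    (Icc_subset_Icc (hmono i.zero_le) (hmono hj)).trans (hφ.convex.ordConnected.out hS₀ hS)
  have hℓα : ∀ k, α k ≤ α k + ℓ := fun k => le_add_of_nonneg_right hℓ
  rcases antitoneOn_or_monotoneOn_of_quasiconcaveOn hφ (α N) with hanti | hmon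
  · have hdrop : ∀ k < N, -φ (α (N + k)) + κ * ℓ ≤ -φ (α (N + (k + 1))) := fun k hk => by
      have hanti' : AntitoneOn φ (Icc (α (N + k)) (α (N + k + 1))) := hanti.mono fun t ht =>
        ⟨hαS _ _ (by omega) ht, (hmono (Nat.le_add_right N k)).trans ht.1⟩
      have hzone := add_mul_sub_le_of_antitoneOn_of_risesFrom (hℓα (N + k)) hκ
        (hanti'.mono (Icc_subset_Icc_right (hα _))) (hrise (N + k) (by omega))
      have hgap : φ (α (N + k + 1)) ≤ φ (α (N + k) + ℓ) :=
        hanti' ⟨hℓα _, hα _⟩ ⟨(hℓα _).trans (hα _), le_rfl⟩ (hα _)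
      rw [add_sub_cancel_left] at hzone
      rw [← add_assoc]
      linarith
    have hsum := add_mul_le_of_forall_add_le (u := fun k => -φ (α (N + k))) hdrop
    rw [add_zero, ← two_mul] at hsum
    linarith [(hmM N (by omega)).2, (hmM (2 * N) le_rfl).1]
  · have hclimb : ∀ k < N, φ (α k) + κ * ℓ ≤ φ (α (k + 1)) := fun k hk => by
      have hmon' : MonotoneOn φ (Icc (α k) (α (k + 1))) := hmon.mono fun t ht =>
        ⟨hαS _ _ (by omega) ht, ht.2.trans (hmono hk)⟩
      have hzone := add_mul_sub_le_of_monotoneOn_of_risesFrom (hℓα k) hκ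
        (hmon'.mono (Icc_subset_Icc_right (hα _))) (hrise k (by omega))
      have hgap : φ (α k + ℓ) ≤ φ (α (k + 1)) :=
        hmon' ⟨hℓα _, hα _⟩ ⟨(hℓα _).trans (hα _), le_rfl⟩ (hα _)
      rw [add_sub_cancel_left] at hzone
      linarith
    have hsum := add_mul_le_of_forall_add_le (u := fun k => φ (α k)) hclimb
    linarith [(hmM 0 (Nat.zero_le _)).1, (hmM N (by omega)).2]

end OneDim

section Height

variable {X : Type*} [TopologicalSpace X] {f q : X → ℝ} {c r α β κ : ℝ} {x y : X}

theorem superlevelComponent_subset_preimage_Ioo (hq : Continuous q) (hx : q x ∈ Ioo α β)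
    (hα : ∀ y, q y = α → f y ≤ r) (hβ : ∀ y, q y = β → f y ≤ r) :
    superlevelComponent f r x ⊆ q ⁻¹' Ioo α β := by
  refine superlevelComponent_subset_of_frontier_le (isOpen_Ioo.preimage hq) hx fun y hy => ?_
  have hqy := hq.frontier_preimage_subset _ hy
  rw [frontier_Ioo (hx.1.trans hx.2)] at hqy
  exact hqy.elim (hα y) (hβ y)

theorem uIcc_diff_singleton_subset {S : Set ℝ} (hS : S.OrdConnected) {s t : ℝ} (hs : s ∈ S)
    (ht : t ∈ closure S) : uIcc s t \ {t} ⊆ S := by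
  rintro u ⟨hu, hut⟩
  rcases mem_uIcc.1 hu with h | h
  · obtain ⟨v, huv, hv⟩ := mem_closure_iff.1 ht _ isOpen_Ioi (h.2.lt_of_ne hut)
    exact hS.out hs hv ⟨h.1, huv.le⟩
  · obtain ⟨v, hvu, hv⟩ := mem_closure_iff.1 ht _ isOpen_Iio (h.1.lt_of_ne' hut)
    exact hS.out hv hs ⟨hvu.le, h.2⟩

theorem exists_isLocalMax_of_fibers_le (hf : Continuous f) (hq : IsProperMap q)
    (hx : q x ∈ Icc α β) (hr : r < f x) (hα : ∀ y, q y = α → f y ≤ r)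
    (hβ : ∀ y, q y = β → f y ≤ r) : ∃ z, q z ∈ Ioo α β ∧ IsLocalMax f z := by
  obtain ⟨z, hz, hmax⟩ :=
    (hq.isCompact_preimage isCompact_Icc).exists_isMaxOn ⟨x, hx⟩ hf.continuousOn
  have hrz : r < f z := hr.trans_le (hmax hx)
  have hαz : α < q z := hz.1.lt_of_ne fun h => (hα z h.symm).not_gt hrz
  have hzβ : q z < β := hz.2.lt_of_ne fun h => (hβ z h).not_gt hrz
  exact ⟨z, ⟨hαz, hzβ⟩,
    hmax.isLocalMax (hq.continuous.continuousAt.preimage_mem_nhds (Icc_mem_nhds hαz hzβ))⟩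

theorem uIcc_diff_singleton_subset_image_superlevelComponent (hq : Continuous q) (hx : c < f x)
    (hy : y ∈ closure (superlevelComponent f c x)) :
    uIcc (q x) (q y) \ {q y} ⊆ q '' superlevelComponent f c x :=
  uIcc_diff_singleton_subset
    (isPreconnected_superlevelComponent.image q hq.continuousOn).ordConnected
    ⟨x, mem_superlevelComponent_self hx, rfl⟩ (mem_closure_image hq.continuousAt hy)

theorem bddBelow_setOf_superlevelComponent_subset (hf : Continuous f) (hq : IsProperMap q)
    (hsurj : q.Surjective) (hconn : IsPreconnected (q ⁻¹' Icc α β)) (hx : q x ∈ Icc α β) :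
    BddBelow {c | superlevelComponent f c x ⊆ q ⁻¹' Ioo α β} := by
  obtain ⟨z, -, hmin⟩ :=
    (hq.isCompact_preimage isCompact_Icc).exists_isMinOn ⟨x, hx⟩ hf.continuousOn
  obtain ⟨w, hw⟩ := hsurj β
  refine ⟨f z, fun c hc => not_lt.1 fun hcz => ?_⟩
  have hwin : ∀ y ∈ q ⁻¹' Icc α β, c < f y := fun y hy => hcz.trans_le (hmin hy)
  have hwc : w ∈ superlevelComponent f c x :=
    subset_superlevelComponent hconn hwin hx (mem_superlevelComponent_self (hwin x hx))
      (mem_preimage.2 (hw.symm ▸ right_mem_Icc.2 (hx.1.trans hx.2)))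
  exact (hc hwc).2.ne hw

theorem closure_subset_preimage_Icc (hq : Continuous q) {C : Set X} (hC : C ⊆ q ⁻¹' Ioo α β) :
    closure C ⊆ q ⁻¹' Icc α β :=
  closure_minimal (hC.trans (preimage_mono Ioo_subset_Icc_self)) (isClosed_Icc.preimage hq)

theorem exists_isGreatest_image_inter_fiber [LocallyConnectedSpace X] (hf : Continuous f)
    (hq : Continuous q) (hK : IsCompact (closure (superlevelComponent f c x))) {t : ℝ}
    (ht : t ∈ q '' superlevelComponent f c x) :
    ∃ v, IsGreatest (f '' (superlevelComponent f c x ∩ q ⁻¹' {t})) v := by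
  obtain ⟨y, hy, hyt⟩ := ht
  obtain ⟨z, hz, hmax⟩ :=
    (hK.inter_right ((isClosed_singleton (x := t)).preimage hq)).exists_isMaxOn
      ⟨y, subset_closure hy, hyt⟩ hf.continuousOn
  have hcz : c < f z := (lt_of_mem_superlevelComponent hy).trans_le (hmax ⟨subset_closure hy, hyt⟩)
  refine ⟨f z, ⟨z, ⟨mem_superlevelComponent_of_mem_closure hf hz.1 hcz, hz.2⟩, rfl⟩, ?_⟩
  rintro _ ⟨w, hw, rfl⟩
  exact hmax ⟨subset_closure hw.1, hw.2⟩

/-- The height function `q` varies at unit speed along a curve from `y` on which `f` grows at rate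
`κ`, unless `f` already grows within the fibre of `q` through `y`. -/
def IsSteepAlong (f q : X → ℝ) (κ : ℝ) (y : X) : Prop :=
  IsLocalMaxOn f (q ⁻¹' {q y}) y → ∃ σ : ℝ, (σ = 1 ∨ σ = -1) ∧ ∃ γ : ℝ → X,
    Tendsto γ (𝓝[>] 0) (𝓝 y) ∧
      ∀ᶠ s in 𝓝[>] 0, q (γ s) = q y + σ * s ∧ f y + κ * s ≤ f (γ s)

theorem IsSteepAlong.exists_gt (h : IsSteepAlong f q κ y) (hκ : 0 < κ)
    (hmax : IsLocalMaxOn f (q ⁻¹' {q y}) y) : ∃ z, f y < f z := by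
  obtain ⟨σ, -, γ, -, hrise⟩ := h hmax
  obtain ⟨s, hs, hs0⟩ := (hrise.and self_mem_nhdsWithin).exists
  exact ⟨γ s, (lt_add_of_pos_right _ (mul_pos hκ hs0)).trans_le hs.2⟩

theorem IsSteepAlong.risesFrom (h : IsSteepAlong f q κ y) {C : Set X} (hC : IsOpen C) (hy : y ∈ C)
    {φ : ℝ → ℝ} (hφ : ∀ t ∈ q '' C, IsGreatest (f '' (C ∩ q ⁻¹' {t})) (φ t))
    (hmax : f y = φ (q y)) : RisesFrom φ κ (q y) := by
  have hloc : IsLocalMaxOn f (q ⁻¹' {q y}) y := by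
    filter_upwards [self_mem_nhdsWithin, mem_nhdsWithin_of_mem_nhds (hC.mem_nhds hy)]
      with z hzq hzC
    exact hmax ▸ (hφ _ (mem_image_of_mem q hy)).2 ⟨z, ⟨hzC, hzq⟩, rfl⟩
  obtain ⟨σ, hσ, γ, hγ, hrise⟩ := h hloc
  refine ⟨σ, hσ, ?_⟩
  filter_upwards [hrise, hγ.eventually_mem (hC.mem_nhds hy)] with s hs hsC
  have hle : f (γ s) ≤ φ (q y + σ * s) :=
    (hφ _ ⟨γ s, hsC, hs.1⟩).2 ⟨γ s, ⟨hsC, hs.1⟩, rfl⟩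
  exact hmax ▸ hs.2.trans hle

variable [LocallyConnectedSpace X] [LocallyCompactSpace X] [T2Space X]

theorem exists_superlevelComponent_reaching (hf : Continuous f) (hq : IsProperMap q)
    (hsurj : q.Surjective) (hconn : IsPreconnected (q ⁻¹' Icc α β))
    (hreg : ∀ y, q y ∈ Icc α β → ¬IsLocalMax f y → IsRegularFromAbove f y)
    (hx : q x ∈ Icc α β) (hr : r < f x) (hsub : superlevelComponent f r x ⊆ q ⁻¹' Ioo α β) :
    ∃ c < f x, superlevelComponent f c x ⊆ q ⁻¹' Ioo α β ∧
      ∃ y ∈ closure (superlevelComponent f c x), q y = α ∨ q y = β := by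
  set J := {c | superlevelComponent f c x ⊆ q ⁻¹' Ioo α β}
  have hJ : BddBelow J := bddBelow_setOf_superlevelComponent_subset hf hq hsurj hconn hx
  have hcx : sInf J < f x := (csInf_le hJ hsub).trans_lt hr
  have hcJ : superlevelComponent f (sInf J) x ⊆ q ⁻¹' Ioo α β := fun y hy => by
    obtain ⟨d, hd, hyd⟩ := exists_gt_mem_superlevelComponent hf hy
    obtain ⟨e, heJ, hed⟩ := exists_lt_of_csInf_lt ⟨r, hsub⟩ hd
    exact heJ (superlevelComponent_subset_of_le hed.le hyd)
  refine ⟨sInf J, hcx, hcJ, ?_⟩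
  by_contra! hends
  have hcl := closure_subset_preimage_Icc hq.continuous hcJ
  have hK := (hq.isCompact_preimage isCompact_Icc).of_isClosed_subset isClosed_closure hcl
  obtain ⟨d, hd, hdJ⟩ := exists_superlevelComponent_subset hf hcx hK
    (fun y hy => hreg y (hcl hy)) (isOpen_Ioo.preimage hq.continuous)
    (fun y hy => ⟨(hcl hy).1.lt_of_ne' (hends y hy).1, (hcl hy).2.lt_of_ne (hends y hy).2⟩)
  exact (csInf_le hJ hdJ).not_gt hd

theorem quasiconcaveOn_of_isGreatest_fiber (hf : Continuous f) (hq : Continuous q)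
    (hK : IsCompact (closure (superlevelComponent f c x)))
    (hreg : ∀ y ∈ closure (superlevelComponent f c x),
      ¬IsLocalMax f y → IsRegularFromAbove f y)
    {φ : ℝ → ℝ} (hφ : ∀ t ∈ q '' superlevelComponent f c x,
      IsGreatest (f '' (superlevelComponent f c x ∩ q ⁻¹' {t})) (φ t)) :
    QuasiconcaveOn ℝ (q '' superlevelComponent f c x) φ := by
  have hord : ∀ {d y}, (q '' superlevelComponent f d y).OrdConnected := fun {d y} =>
    (isPreconnected_superlevelComponent.image q hq.continuousOn).ordConnected
  refine fun r => OrdConnected.convex ⟨?_⟩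
  rintro s ⟨hs, hrs⟩ u ⟨hu, hru⟩ t ht
  have htS : t ∈ q '' superlevelComponent f c x := hord.out hs hu ht
  refine ⟨htS, not_lt.1 fun htr => ?_⟩
  obtain ⟨y, ⟨hy, rfl⟩, hfy⟩ := (hφ s hs).1
  obtain ⟨z, ⟨hz, rfl⟩, hfz⟩ := (hφ u hu).1
  obtain ⟨v, ⟨hv, -⟩, hfv⟩ := (hφ t htS).1
  have hct : c ≤ φ t := hfv ▸ (lt_of_mem_superlevelComponent hv).le
  have hyt : φ t < f y := hfy ▸ htr.trans_le hrs
  have hzy : z ∈ superlevelComponent f (φ t) y :=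
    mem_superlevelComponent_of_lt hf hK hreg hct hy hz hyt (hfz ▸ htr.trans_le hru)
  obtain ⟨w, hw, rfl⟩ := hord.out ⟨y, mem_superlevelComponent_self hyt, rfl⟩ ⟨z, hzy, rfl⟩ ht
  have hwx : w ∈ superlevelComponent f c x :=
    superlevelComponent_eq hy ▸ superlevelComponent_subset_of_le hct hw
  exact ((hφ _ htS).2 ⟨w, ⟨hwx, rfl⟩, rfl⟩).not_gt (lt_of_mem_superlevelComponent hw)

theorem mul_le_sub_of_mem_image_superlevelComponent (hf : Continuous f) (hq : Continuous q)
    (hK : IsCompact (closure (superlevelComponent f c x)))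
    (hreg : ∀ y ∈ closure (superlevelComponent f c x),
      ¬IsLocalMax f y → IsRegularFromAbove f y)
    (hκ : 0 < κ) {ℓ : ℝ} (hℓ : 0 ≤ ℓ) {α : ℕ → ℝ} (hα : ∀ k, α k + ℓ ≤ α (k + 1)) {m M : ℝ}
    (hzone : ∀ k y, q y ∈ Icc (α k) (α k + ℓ) → f y ∈ Icc m M ∧ IsSteepAlong f q κ y) {N : ℕ}
    (h₀ : α 0 ∈ q '' superlevelComponent f c x)
    (hN : α (2 * N) ∈ q '' superlevelComponent f c x) : N * (κ * ℓ) ≤ M - m := by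
  set S := q '' superlevelComponent f c x
  have hex : ∀ t ∈ S, ∃ v, IsGreatest (f '' (superlevelComponent f c x ∩ q ⁻¹' {t})) v :=
    fun t ht => exists_isGreatest_image_inter_fiber hf hq hK ht
  choose! φ hφ using hex
  have hquasi := quasiconcaveOn_of_isGreatest_fiber hf hq hK hreg hφ
  have hmono : Monotone α := monotone_nat_of_le_succ fun k => by linarith [hα k]
  have hS : Icc (α 0) (α (2 * N)) ⊆ S := hquasi.convex.ordConnected.out h₀ hN
  refine mul_le_sub_of_quasiconcaveOn_of_risesFrom hquasi hκ hℓ hα h₀ hN (fun k hk => ?_)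
    fun k hk t ht => ?_
  · obtain ⟨y, ⟨-, hyk⟩, hfy⟩ := (hφ (α k) (hS ⟨hmono k.zero_le, hmono hk⟩)).1
    exact hfy ▸ (hzone k y (hyk ▸ ⟨le_rfl, le_add_of_nonneg_right hℓ⟩)).1
  · have htS : t ∈ S :=
      hS ⟨(hmono k.zero_le).trans ht.1.le, ht.2.le.trans ((hα k).trans (hmono hk))⟩
    obtain ⟨y, ⟨hy, rfl⟩, hfy⟩ := (hφ t htS).1
    exact (hzone k y (Ioo_subset_Icc_self ht)).2.risesFrom (isOpen_superlevelComponent hf) hy hφ hfy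

theorem exists_not_isLocalMax_and_not_isRegularFromAbove (hf : Continuous f) (hq : IsProperMap q)
    (hsurj : q.Surjective) (hconn : ∀ α β, IsPreconnected (q ⁻¹' Icc α β))
    (hκ : 0 < κ) {ℓ : ℝ} (hℓ : 0 < ℓ) {α : ℕ → ℝ} (hα : ∀ k, α k + ℓ ≤ α (k + 1)) {m M : ℝ}
    (hzone : ∀ k y, q y ∈ Icc (α k) (α k + ℓ) → f y ∈ Icc m M ∧ IsSteepAlong f q κ y)
    {p : ℕ → X} (hp : ∀ k, q (p k) ∈ Icc (α k) (α (k + 1))) (hM : ∀ k, M < f (p k)) :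
    ∃ y, α 0 ≤ q y ∧ ¬IsLocalMax f y ∧ ¬IsRegularFromAbove f y := by
  by_contra! hreg
  obtain ⟨N, hN⟩ := exists_nat_gt ((M - m) / (κ * ℓ))
  rw [div_lt_iff₀ (mul_pos hκ hℓ)] at hN
  have hmono : StrictMono α := strictMono_nat_of_lt_succ fun k => by linarith [hα k]
  have hfiber : ∀ k y, q y = α k → f y ≤ M := fun k y hy =>
    (hzone k y (hy ▸ ⟨le_rfl, le_add_of_nonneg_right hℓ.le⟩)).1.2
  set x := p (2 * N + 1)
  obtain ⟨hx, hx'⟩ : α (2 * N + 1) ≤ q x ∧ q x ≤ α (2 * N + 2) := hp (2 * N + 1)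
  have hbetween : ∀ {i j}, i < 2 * N + 1 → 2 * N + 2 < j → q x ∈ Ioo (α i) (α j) :=
    fun hi hj => ⟨(hmono hi).trans_le hx, hx'.trans_lt (hmono hj)⟩
  have hsub := superlevelComponent_subset_preimage_Ioo hq.continuous
    (hbetween (show 0 < 2 * N + 1 by omega) (show 2 * N + 2 < 4 * N + 3 by omega))
    (hfiber _) (hfiber _)
  obtain ⟨c, hcx, hcw, y, hy, hqy⟩ := exists_superlevelComponent_reaching hf hq hsurj
    (hconn _ _) (fun y hy => hreg y hy.1)
    (Ioo_subset_Icc_self (hbetween (by omega) (by omega))) (hM _) hsub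
  have hcl := closure_subset_preimage_Icc hq.continuous hcw
  have hbound : ∀ j, α j ∈ q '' superlevelComponent f c x →
      α (j + 2 * N) ∈ q '' superlevelComponent f c x → N * (κ * ℓ) ≤ M - m := fun j hj hj' =>
    mul_le_sub_of_mem_image_superlevelComponent (α := fun k => α (j + k)) hf hq.continuous
      ((hq.isCompact_preimage isCompact_Icc).of_isClosed_subset isClosed_closure hcl)
      (fun y hy => hreg y (hcl hy).1) hκ hℓ.le (fun k => hα (j + k)) (fun k => hzone (j + k)) hj hj'
  have hspan := uIcc_diff_singleton_subset_image_superlevelComponent hq.continuous hcx hy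
  rcases hqy with hqy | hqy <;> rw [hqy] at hspan
  · have hleft : ∀ j, 0 < j → j ≤ 2 * N + 1 → α j ∈ q '' superlevelComponent f c x :=
      fun j h0 hj => hspan
        ⟨mem_uIcc.2 (.inr ⟨hmono.monotone h0.le, (hmono.monotone hj).trans hx⟩), (hmono h0).ne'⟩
    exact hN.not_ge (hbound 1 (hleft _ (by omega) (by omega)) (hleft _ (by omega) (by omega)))
  · have hright : ∀ j, 2 * N + 2 ≤ j → j < 4 * N + 3 → α j ∈ q '' superlevelComponent f c x :=
      fun j hj h1 => hspan
        ⟨mem_uIcc.2 (.inl ⟨hx'.trans (hmono.monotone hj), hmono.monotone h1.le⟩), (hmono h1).ne⟩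
    exact hN.not_ge
      (hbound (2 * N + 2) (hright _ (by omega) (by omega)) (hright _ (by omega) (by omega)))

end Height

section Inward

variable {E F : Type*} [NormedAddCommGroup E] [NormedSpace ℝ E] [NormedAddCommGroup F]
  [NormedSpace ℝ F] {S T : Set E} {x v : E}

/-- The vector `v` does not point out of `S` at `x`, locally uniformly in the base point: short
segments in direction `v` starting at points of `S` near `x` stay in `S`. -/
def IsInwardAt (S : Set E) (x v : E) : Prop :=
  ∀ᶠ z : E × ℝ in 𝓝[S] x ×ˢ 𝓝[≥] 0, z.1 + z.2 • v ∈ S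

theorem IsInwardAt.inter (hS : IsInwardAt S x v) (hT : IsInwardAt T x v) :
    IsInwardAt (S ∩ T) x v :=
  (hS.filter_mono (prod_mono_left _ (nhdsWithin_mono x inter_subset_left))).and
    (hT.filter_mono (prod_mono_left _ (nhdsWithin_mono x inter_subset_right)))

theorem IsInwardAt.preimage {R : Set F} (L : E →L[ℝ] F) (hR : IsInwardAt R (L x) (L v)) :
    IsInwardAt (L ⁻¹' R) x v := by
  have hL : Tendsto L (𝓝[L ⁻¹' R] x) (𝓝[R] (L x)) :=
    L.continuous.continuousWithinAt.tendsto_nhdsWithin (mapsTo_preimage L R)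
  simpa [IsInwardAt] using (hL.prodMap tendsto_id).eventually hR

theorem tendsto_add_smul_nhds (x v : E) (l : Filter E) (hl : l ≤ 𝓝 x) :
    Tendsto (fun z : E × ℝ => z.1 + z.2 • v) (l ×ˢ 𝓝[≥] 0) (𝓝 x) := by
  have h : Continuous fun z : E × ℝ => z.1 + z.2 • v := by fun_prop
  have h0 := h.tendsto (x, 0)
  rw [nhds_prod_eq, zero_smul, add_zero] at h0
  exact h0.mono_left (prod_mono hl nhdsWithin_le_nhds)

theorem isInwardAt_Iic {a b u : ℝ} (ha : a ≤ b) (hu : a = b → u ≤ 0) :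
    IsInwardAt (Iic b) a u := by
  rcases ha.lt_or_eq with hab | hab
  · exact (tendsto_add_smul_nhds a u _ nhdsWithin_le_nhds).eventually_le_const hab
  · filter_upwards [prod_mem_prod self_mem_nhdsWithin self_mem_nhdsWithin] with z hz
    exact add_le_of_le_of_nonpos hz.1 (smul_nonpos_of_nonneg_of_nonpos hz.2 (hu hab))

theorem isInwardAt_Ici {a b u : ℝ} (ha : b ≤ a) (hu : a = b → 0 ≤ u) :
    IsInwardAt (Ici b) a u := by
  rcases ha.lt_or_eq with hab | hab
  · exact (tendsto_add_smul_nhds a u _ nhdsWithin_le_nhds).eventually_const_le hab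
  · filter_upwards [prod_mem_prod self_mem_nhdsWithin self_mem_nhdsWithin] with z hz
    exact le_add_of_le_of_nonneg hz.1 (smul_nonneg hz.2 (hu hab.symm))

theorem isInwardAt_Icc {a b c u : ℝ} (ha : a ∈ Icc b c) (hb : a = b → 0 ≤ u) (hc : a = c → u ≤ 0) :
    IsInwardAt (Icc b c) a u :=
  (isInwardAt_Ici ha.1 hb).inter (isInwardAt_Iic ha.2 hc)

theorem IsInwardAt.tendsto (hv : IsInwardAt S x v) :
    Tendsto (fun z : E × ℝ => z.1 + z.2 • v) (𝓝[S] x ×ˢ 𝓝[≥] 0) (𝓝[S] x) :=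
  tendsto_nhdsWithin_iff.2 ⟨tendsto_add_smul_nhds x v _ nhdsWithin_le_nhds, hv⟩

theorem IsInwardAt.tendsto_line (hv : IsInwardAt S x v) (hx : x ∈ S) :
    Tendsto (fun s : ℝ => x + s • v) (𝓝[>] 0) (𝓝[S] x) :=
  hv.tendsto.comp ((tendsto_const_pure.mono_right (pure_le_nhdsWithin hx)).prodMk
    (tendsto_id.mono_left (nhdsWithin_mono 0 Ioi_subset_Ici_self)))

theorem IsInwardAt.mem_posTangentConeAt (hv : IsInwardAt S x v) (hx : x ∈ S) :
    v ∈ posTangentConeAt S x :=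
  mem_posTangentConeAt_of_frequently_mem
    ((hv.tendsto_line hx).eventually self_mem_nhdsWithin).frequently

variable {f : E → ℝ} {κ h c : ℝ}

theorem hasDerivWithinAt_comp_line (hf : DifferentiableOn ℝ f S) {I : Set ℝ} {y : E}
    (hI : MapsTo (fun s : ℝ => y + s • v) I S) {s : ℝ} (hs : s ∈ I) :
    HasDerivWithinAt (fun s : ℝ => f (y + s • v)) (fderivWithin ℝ f S (y + s • v) v) I s := by
  have hline : HasDerivWithinAt (fun s : ℝ => y + s • v) v I s := by
    simpa using ((hasDerivWithinAt_id s I).smul_const v).const_add y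
  exact (hf _ (hI hs)).hasFDerivWithinAt.comp_hasDerivWithinAt s hline hI

theorem monotoneOn_sub_mul_of_le_fderivWithin (hf : DifferentiableOn ℝ f S) {I : Set ℝ}
    (hIc : Convex ℝ I) {y : E} (hI : MapsTo (fun s : ℝ => y + s • v) I S)
    (hκ : ∀ s ∈ I, κ ≤ fderivWithin ℝ f S (y + s • v) v) :
    MonotoneOn (fun s : ℝ => f (y + s • v) - κ * s) I := by
  have hd : ∀ s ∈ I, HasDerivWithinAt (fun s : ℝ => f (y + s • v) - κ * s)
      (fderivWithin ℝ f S (y + s • v) v - κ) I s := fun s hs => by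
    simpa only [mul_one, id] using
      (hasDerivWithinAt_comp_line hf hI hs).fun_sub ((hasDerivWithinAt_id s I).const_mul κ)
  exact monotoneOn_of_hasDerivWithinAt_nonneg hIc (fun s hs => (hd s hs).continuousWithinAt)
    (fun s hs => (hd s (interior_subset hs)).mono interior_subset)
    fun s hs => sub_nonneg.2 (hκ s (interior_subset hs))

theorem IsInwardAt.exists_monotoneOn (hv : IsInwardAt S x v) (hf : ContDiffOn ℝ 1 f S)
    (hS : UniqueDiffOn ℝ S) (hx : x ∈ S) (hκ : κ < fderivWithin ℝ f S x v) :
    ∃ h > 0, ∀ᶠ y in 𝓝[S] x, MapsTo (fun s : ℝ => y + s • v) (Icc 0 h) S ∧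
      MonotoneOn (fun s : ℝ => f (y + s • v) - κ * s) (Icc 0 h) := by
  have hcont : ContinuousWithinAt (fun y => fderivWithin ℝ f S y v) S x :=
    (hf.continuousOn_fderivWithin hS le_rfl x hx).clm_apply continuousWithinAt_const
  have hstay := hv.and (hv.tendsto.eventually (hcont.eventually_const_lt hκ))
  obtain ⟨p, hp, q, hq, hpq⟩ := eventually_prod_iff.1 hstay
  obtain ⟨h, hh, hsub⟩ := mem_nhdsGE_iff_exists_Icc_subset.1 hq
  refine ⟨h, hh, hp.mono fun y hy => ?_⟩
  have hmaps : MapsTo (fun s : ℝ => y + s • v) (Icc 0 h) S := fun s hs => (hpq hy (hsub hs)).1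
  exact ⟨hmaps, monotoneOn_sub_mul_of_le_fderivWithin (hf.differentiableOn one_ne_zero)
    (convex_Icc 0 h) hmaps fun s hs => (hpq hy (hsub hs)).2.le⟩

theorem isPreconnected_image_add_smul_inter {V : Set E} (hV : IsPreconnected V) (hh : 0 ≤ h)
    (hmono : ∀ y ∈ V, MonotoneOn (fun s : ℝ => f (y + s • v)) (Icc 0 h))
    (htop : ∀ y ∈ V, c < f (y + h • v)) :
    IsPreconnected ((fun z : E × ℝ => z.1 + z.2 • v) '' (V ×ˢ Icc 0 h) ∩ {z | c < f z}) := by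
  rcases V.eq_empty_or_nonempty with rfl | ⟨x, hx⟩
  · simp [isPreconnected_empty]
  refine isPreconnected_of_forall (x + h • v) ?_
  rintro _ ⟨⟨⟨y, s⟩, ⟨hy, hs⟩, rfl⟩, hcy⟩
  refine ⟨(fun t : ℝ => y + t • v) '' Icc s h ∪ (fun y => y + h • v) '' V, ?_,
    .inr ⟨x, hx, rfl⟩, .inl ⟨s, left_mem_Icc.2 hs.2, rfl⟩, ?_⟩
  · rintro w (⟨t, ht, rfl⟩ | ⟨w, hw, rfl⟩)
    · exact ⟨⟨(y, t), ⟨hy, hs.1.trans ht.1, ht.2⟩, rfl⟩,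
        hcy.trans_le (hmono y hy hs ⟨hs.1.trans ht.1, ht.2⟩ ht.1)⟩
    · exact ⟨⟨(w, h), ⟨hw, right_mem_Icc.2 hh⟩, rfl⟩, htop w hw⟩
  · exact IsPreconnected.union (y + h • v) ⟨h, right_mem_Icc.2 hs.2, rfl⟩ ⟨y, hy, rfl⟩
      (isPreconnected_Icc.image _ (by fun_prop)) (hV.image _ (by fun_prop))

theorem image_add_smul_inter_subset_closure {V : Set E}
    (hmono : ∀ y ∈ V, StrictMonoOn (fun s : ℝ => f (y + s • v)) (Icc 0 h))
    (htop : ∀ y ∈ V, c < f (y + h • v)) :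
    (fun z : E × ℝ => z.1 + z.2 • v) '' (V ×ˢ Icc 0 h) ∩ {z | c ≤ f z} ⊆
      closure ((fun z : E × ℝ => z.1 + z.2 • v) '' (V ×ˢ Icc 0 h) ∩ {z | c < f z}) := by
  rintro _ ⟨⟨⟨y, s⟩, ⟨hy, hs⟩, rfl⟩, hcy⟩
  rcases hs.2.eq_or_lt with rfl | hsh
  · exact subset_closure ⟨⟨(y, s), ⟨hy, hs⟩, rfl⟩, htop y hy⟩
  · have hline : Continuous fun t : ℝ => y + t • v := by fun_prop
    refine mem_closure_of_tendsto (b := 𝓝[>] s)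
      ((hline.tendsto s).mono_left nhdsWithin_le_nhds) ?_
    filter_upwards [Ioc_mem_nhdsGT hsh] with t ht
    have ht0 : t ∈ Icc 0 h := ⟨hs.1.trans ht.1.le, ht.2⟩
    exact ⟨⟨(y, t), ⟨hy, ht0⟩, rfl⟩, lt_of_le_of_lt hcy (hmono y hy hs ht0 ht.1)⟩

theorem IsInwardAt.exists_strictMonoOn (hv : IsInwardAt S x v) (hf : ContDiffOn ℝ 1 f S)
    (hS : UniqueDiffOn ℝ S) (hx : x ∈ S) (hpos : 0 < fderivWithin ℝ f S x v) :
    ∃ h ≥ 0, ∀ᶠ y in 𝓝[S] x, MapsTo (fun s : ℝ => y + s • v) (Icc 0 h) S ∧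
      StrictMonoOn (fun s : ℝ => f (y + s • v)) (Icc 0 h) ∧ f x < f (y + h • v) := by
  obtain ⟨κ, hκ0, hκ⟩ := exists_between hpos
  obtain ⟨h, hh, hev⟩ := hv.exists_monotoneOn hf hS hx hκ
  have hev' : ∀ᶠ y in 𝓝[S] x, MapsTo (fun s : ℝ => y + s • v) (Icc 0 h) S ∧
      StrictMonoOn (fun s : ℝ => f (y + s • v)) (Icc 0 h) :=
    hev.mono fun y hy => ⟨hy.1, fun s hs t ht hst => by
      have : f (y + s • v) - κ * s ≤ f (y + t • v) - κ * t := hy.2 hs ht hst.le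
      change f (y + s • v) < f (y + t • v)
      nlinarith [mul_lt_mul_of_pos_left hst hκ0]⟩
  obtain ⟨hxS, hxmono⟩ := hev'.self_of_nhdsWithin hx
  have htop : f x < f (x + h • v) := by
    simpa using hxmono (left_mem_Icc.2 hh.le) (right_mem_Icc.2 hh.le) hh
  have hshift : Tendsto (fun y => y + h • v) (𝓝[S] x) (𝓝[S] (x + h • v)) :=
    tendsto_nhdsWithin_iff.2 ⟨(continuous_id.add continuous_const).continuousWithinAt,
      hev'.mono fun y hy => hy.1 (right_mem_Icc.2 hh.le)⟩
  have htop' := hshift.eventually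
    ((hf.continuousOn _ (hxS (right_mem_Icc.2 hh.le))).eventually_const_lt htop)
  exact ⟨h, hh.le, (hev'.and htop').mono fun y hy => ⟨hy.1.1, hy.1.2, hy.2⟩⟩

theorem IsInwardAt.isRegularFromAbove {x : S} (hv : IsInwardAt S x v) (hf : ContDiffOn ℝ 1 f S)
    (hS : UniqueDiffOn ℝ S) (hSc : Convex ℝ S) (hpos : 0 < fderivWithin ℝ f S x v) :
    IsRegularFromAbove (fun z : S => f z) x := by
  obtain ⟨h, hh, hev⟩ := hv.exists_strictMonoOn hf hS x.2 hpos
  obtain ⟨r, hr, hball⟩ := Metric.mem_nhdsWithin_iff.1 hev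
  rw [inter_comm] at hball
  have hV : S ∩ Metric.ball (x : E) r ∈ 𝓝[S] (x : E) :=
    inter_mem_nhdsWithin S (Metric.ball_mem_nhds _ hr)
  refine isRegularFromAbove_of_nhdsWithin
    (U := (fun z : E × ℝ => z.1 + z.2 • v) '' ((S ∩ Metric.ball (x : E) r) ×ˢ Icc 0 h))
    (mem_of_superset hV fun y hy => ⟨(y, 0), ⟨hy, left_mem_Icc.2 hh⟩, by simp⟩) ?_ ?_ ?_
  · rintro _ ⟨z, hz, rfl⟩
    exact (hball hz.1).1 hz.2
  · exact isPreconnected_image_add_smul_inter (hSc.inter (convex_ball _ r)).isPreconnected hh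
      (fun y hy => (hball hy).2.1.monotoneOn) fun y hy => (hball hy).2.2
  · exact image_add_smul_inter_subset_closure (fun y hy => (hball hy).2.1)
      fun y hy => (hball hy).2.2

end Inward

section Slab

variable {f : EuclideanSpace ℝ (Fin 3) → ℝ} {x v : EuclideanSpace ℝ (Fin 3)} {a b κ : ℝ}

theorem slab_eq_inter_preimage :
    slab = EuclideanSpace.proj (𝕜 := ℝ) 1 ⁻¹' Icc (-1 : ℝ) 1 ∩
      EuclideanSpace.proj (𝕜 := ℝ) 2 ⁻¹' Icc (-1 : ℝ) 1 :=
  rfl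

theorem isClosed_slab : IsClosed slab :=
  (isClosed_Icc.preimage (EuclideanSpace.proj (𝕜 := ℝ) 1).continuous).inter
    (isClosed_Icc.preimage (EuclideanSpace.proj (𝕜 := ℝ) 2).continuous)

theorem convex_slab : Convex ℝ slab :=
  ((convex_Icc (-1 : ℝ) 1).linear_preimage (EuclideanSpace.proj (𝕜 := ℝ) 1).toLinearMap).inter
    ((convex_Icc (-1 : ℝ) 1).linear_preimage (EuclideanSpace.proj (𝕜 := ℝ) 2).toLinearMap)

theorem add_single_zero_mem_slab_iff {t : ℝ} :
    x + EuclideanSpace.single 0 t ∈ slab ↔ x ∈ slab := by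
  simp [slab]

/-- The bounded piece `[a, b] × [-1,1]²` of the slab. -/
def slabWindow (a b : ℝ) : Set (EuclideanSpace ℝ (Fin 3)) :=
  slab ∩ EuclideanSpace.proj (𝕜 := ℝ) 0 ⁻¹' Icc a b

theorem convex_slabWindow : Convex ℝ (slabWindow a b) :=
  convex_slab.inter
    ((convex_Icc a b).linear_preimage (EuclideanSpace.proj (𝕜 := ℝ) 0).toLinearMap)

theorem isCompact_slabWindow : IsCompact (slabWindow a b) := by
  refine ((isCompact_univ_pi (s := ![Icc a b, Icc (-1 : ℝ) 1, Icc (-1 : ℝ) 1]) fun i => ?_).image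
    (PiLp.continuous_toLp 2 _)).of_isClosed_subset (isClosed_slab.inter (isClosed_Icc.preimage
      (EuclideanSpace.proj (𝕜 := ℝ) 0).continuous)) fun y hy => ⟨y.ofLp, fun i _ => ?_, rfl⟩
  · fin_cases i <;> exact isCompact_Icc
  · fin_cases i
    exacts [hy.2, hy.1.1, hy.1.2]

theorem nonempty_interior_slabWindow (hab : a < b) : (interior (slabWindow a b)).Nonempty := by
  have hopen : ∀ (i : Fin 3) (c d : ℝ), IsOpen (EuclideanSpace.proj (𝕜 := ℝ) i ⁻¹' Ioo c d) :=
    fun i c d => isOpen_Ioo.preimage (EuclideanSpace.proj (𝕜 := ℝ) i).continuous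
  refine ⟨EuclideanSpace.single 0 ((a + b) / 2), interior_maximal (inter_subset_inter
    (inter_subset_inter (preimage_mono Ioo_subset_Icc_self) (preimage_mono Ioo_subset_Icc_self))
    (preimage_mono Ioo_subset_Icc_self))
    (((hopen 1 (-1) 1).inter (hopen 2 (-1) 1)).inter (hopen 0 a b)) ?_⟩
  simp [left_lt_add_div_two.2 hab, add_div_two_lt_right.2 hab]

theorem uniqueDiffOn_slab : UniqueDiffOn ℝ slab :=
  uniqueDiffOn_convex convex_slab
    ((nonempty_interior_slabWindow one_pos).mono (interior_mono inter_subset_left))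

instance instNonemptySlab : Nonempty slab :=
  ⟨0, by simp [slab]⟩

instance instLocallyConnectedSpaceSlab : LocallyConnectedSpace slab :=
  have := convex_slab.locallyPathConnectedSpace
  inferInstance

instance instLocallyCompactSpaceSlab : LocallyCompactSpace slab :=
  isClosed_slab.locallyCompactSpace

/-- The unbounded coordinate `q` of a point `(q, p₁, p₂)` of the slab, as a height function on the
slab. -/
def slabHeight (x : slab) : ℝ :=
  (x : EuclideanSpace ℝ (Fin 3)) 0

theorem image_preimage_slabHeight_Icc : (↑) '' (slabHeight ⁻¹' Icc a b) = slabWindow a b :=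
  Subtype.image_preimage_coe slab (EuclideanSpace.proj (𝕜 := ℝ) 0 ⁻¹' Icc a b)

theorem continuous_slabHeight : Continuous slabHeight := by
  unfold slabHeight
  fun_prop

theorem isProperMap_slabHeight : IsProperMap slabHeight := by
  refine isProperMap_iff_isCompact_preimage.2 ⟨continuous_slabHeight, fun K hK => ?_⟩
  obtain ⟨r, hr⟩ := hK.isBounded.subset_closedBall 0
  rw [Real.closedBall_eq_Icc] at hr
  have hwin : IsCompact (slabHeight ⁻¹' Icc (0 - r) (0 + r)) :=
    Topology.IsInducing.subtypeVal.isCompact_iff.2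
      (image_preimage_slabHeight_Icc ▸ isCompact_slabWindow)
  exact hwin.of_isClosed_subset (hK.isClosed.preimage continuous_slabHeight) (preimage_mono hr)

theorem surjective_slabHeight : slabHeight.Surjective := fun t =>
  ⟨⟨EuclideanSpace.single 0 t, by simp [slab]⟩, by simp [slabHeight]⟩

theorem isPreconnected_preimage_slabHeight_Icc : IsPreconnected (slabHeight ⁻¹' Icc a b) :=
  Topology.IsInducing.subtypeVal.isPreconnected_image.1
    (image_preimage_slabHeight_Icc ▸ convex_slabWindow.isPreconnected)

theorem isInwardAt_slab (hx : x ∈ slab)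
    (h : ∀ i ≠ 0, (x i = -1 → 0 ≤ v i) ∧ (x i = 1 → v i ≤ 0)) : IsInwardAt slab x v := by
  rw [slab_eq_inter_preimage]
  refine .inter (.preimage _ ?_) (.preimage _ ?_)
  exacts [isInwardAt_Icc hx.1 (h 1 (by decide)).1 (h 1 (by decide)).2,
    isInwardAt_Icc hx.2 (h 2 (by decide)).1 (h 2 (by decide)).2]

theorem inner_slabGrad : inner ℝ (slabGrad f x) v = fderivWithin ℝ f slab x v :=
  InnerProductSpace.toDual_symm_apply

theorem slabGrad_apply (i : Fin 3) :
    slabGrad f x i = fderivWithin ℝ f slab x (EuclideanSpace.single i 1) := by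
  simp [← inner_slabGrad, EuclideanSpace.inner_single_right]

theorem fderivWithin_single {i : Fin 3} {c : ℝ} :
    fderivWithin ℝ f slab x (EuclideanSpace.single i c) = c * slabGrad f x i := by
  simp [← inner_slabGrad, EuclideanSpace.inner_single_right]

theorem continuousOn_slabGrad (hf : ContDiffOn ℝ 1 f slab) : ContinuousOn (slabGrad f) slab :=
  (LinearIsometryEquiv.continuous _).comp_continuousOn
    (hf.continuousOn_fderivWithin uniqueDiffOn_slab le_rfl)

theorem GradPointsInward.sign (hin : GradPointsInward f) (hx : x ∈ slab) {i : Fin 3} (hi : i ≠ 0) :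
    (x i = -1 → 0 < slabGrad f x i) ∧ (x i = 1 → slabGrad f x i < 0) := by
  obtain ⟨h1, h1', h2, h2'⟩ := hin x hx
  fin_cases i
  exacts [absurd rfl hi, ⟨h1', h1⟩, ⟨h2', h2⟩]

theorem GradPointsInward.isInwardAt_slabGrad (hin : GradPointsInward f) (hx : x ∈ slab) :
    IsInwardAt slab x (slabGrad f x) :=
  isInwardAt_slab hx fun _ hi =>
    ⟨fun h => ((hin.sign hx hi).1 h).le, fun h => ((hin.sign hx hi).2 h).le⟩

theorem GradPointsInward.isInwardAt_single_slabGrad (hin : GradPointsInward f) (hx : x ∈ slab)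
    (i : Fin 3) (hi : i ≠ 0) : IsInwardAt slab x (EuclideanSpace.single i (slabGrad f x i)) := by
  refine isInwardAt_slab hx fun j _ => ?_
  rcases eq_or_ne j i with rfl | hji
  · simpa using ⟨fun h => ((hin.sign hx hi).1 h).le, fun h => ((hin.sign hx hi).2 h).le⟩
  · simp [hji]

theorem isInwardAt_slab_single_zero (hx : x ∈ slab) (c : ℝ) :
    IsInwardAt slab x (EuclideanSpace.single 0 c) :=
  isInwardAt_slab hx fun i hi => by simp [hi]

theorem isInwardAt_fiber {i j : Fin 3} (hij : i ≠ j) (c : ℝ) :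
    IsInwardAt {y | y j = x j} x (EuclideanSpace.single i c) := by
  filter_upwards [prod_mem_prod self_mem_nhdsWithin univ_mem] with z hz
  simpa [hij.symm] using hz.1

theorem GradPointsInward.slabGrad_eq_zero_of_isLocalMaxOn (hin : GradPointsInward f)
    (hf : DifferentiableWithinAt ℝ f slab x) (hx : x ∈ slab) (hmax : IsLocalMaxOn f slab x) :
    slabGrad f x = 0 := by
  have hle := hmax.hasFDerivWithinAt_nonpos hf.hasFDerivWithinAt
    ((hin.isInwardAt_slabGrad hx).mem_posTangentConeAt hx)
  rw [← inner_slabGrad] at hle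
  exact real_inner_self_nonpos.1 hle

theorem GradPointsInward.slabGrad_apply_eq_zero_of_isLocalMaxOn (hin : GradPointsInward f)
    (hf : DifferentiableWithinAt ℝ f slab x) (hx : x ∈ slab)
    (hmax : IsLocalMaxOn f (slab ∩ {y | y 0 = x 0}) x) {i : Fin 3} (hi : i ≠ 0) :
    slabGrad f x i = 0 := by
  have hle := hmax.hasFDerivWithinAt_nonpos (hf.hasFDerivWithinAt.mono inter_subset_left)
    (((hin.isInwardAt_single_slabGrad hx i hi).inter
      (isInwardAt_fiber hi _)).mem_posTangentConeAt ⟨hx, rfl⟩)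
  rw [fderivWithin_single] at hle
  exact mul_self_eq_zero.1 (hle.antisymm (mul_self_nonneg _))

theorem GradPointsInward.isRegularFromAbove (hin : GradPointsInward f)
    (hf : ContDiffOn ℝ 1 f slab) {x : slab} (hx : slabGrad f x ≠ 0) :
    IsRegularFromAbove (fun z : slab => f z) x :=
  (hin.isInwardAt_slabGrad x.2).isRegularFromAbove hf uniqueDiffOn_slab convex_slab
    (inner_slabGrad ▸ real_inner_self_pos.2 hx)

theorem isLocalMax_slab_iff {x : slab} :
    IsLocalMax (fun z : slab => f z) x ↔ IsLocalMaxOn f slab x :=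
  eventually_nhds_subtype_iff slab x fun z => f z ≤ f x

theorem isLocalMaxOn_fiber_iff {x : slab} :
    IsLocalMaxOn (fun z : slab => f z) (slabHeight ⁻¹' {slabHeight x}) x ↔
      IsLocalMaxOn f (slab ∩ {y | y 0 = (x : EuclideanSpace ℝ (Fin 3)) 0}) x := by
  simp only [IsLocalMaxOn, IsMaxFilter, eventually_nhdsWithin_iff, mem_preimage, slabHeight,
    mem_singleton_iff, mem_inter_iff, mem_ofPred_eq]
  rw [eventually_nhds_subtype_iff slab x fun y =>
    y 0 = (x : EuclideanSpace ℝ (Fin 3)) 0 → f y ≤ f x, eventually_nhdsWithin_iff]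
  simp only [and_imp]

theorem GradPointsInward.isSteepAlong (hin : GradPointsInward f) (hf : ContDiffOn ℝ 1 f slab)
    {x : slab} (hκ : κ < ‖slabGrad f x‖) : IsSteepAlong (fun z : slab => f z) slabHeight κ x := by
  intro hmax
  have hgrad : slabGrad f x = EuclideanSpace.single 0 (slabGrad f x 0) := by
    ext i
    rcases eq_or_ne i 0 with rfl | hi
    · simp
    · simpa [hi] using hin.slabGrad_apply_eq_zero_of_isLocalMaxOn
        (hf.differentiableOn one_ne_zero x x.2) x.2 (isLocalMaxOn_fiber_iff.1 hmax) hi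
  rw [hgrad, PiLp.norm_single, Real.norm_eq_abs] at hκ
  obtain ⟨σ, hσ, hσg⟩ : ∃ σ : ℝ, (σ = 1 ∨ σ = -1) ∧ |slabGrad f x 0| = σ * slabGrad f x 0 := by
    rcases abs_choice (slabGrad f x 0) with h | h
    exacts [⟨1, .inl rfl, by simpa using h⟩, ⟨-1, .inr rfl, by simpa using h⟩]
  rw [hσg, ← fderivWithin_single] at hκ
  have hv := isInwardAt_slab_single_zero x.2 σ
  obtain ⟨h, hh, hev⟩ := hv.exists_monotoneOn hf uniqueDiffOn_slab x.2 hκ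
  have hmono := (hev.self_of_nhdsWithin x.2).2
  let γ : ℝ → slab := fun s =>
    ⟨(x : EuclideanSpace ℝ (Fin 3)) + s • EuclideanSpace.single 0 σ, by
      simpa [slab] using x.2⟩
  refine ⟨σ, hσ, γ, tendsto_subtype_rng.2 ((hv.tendsto_line x.2).mono_right nhdsWithin_le_nhds), ?_⟩
  filter_upwards [Ioo_mem_nhdsGT hh] with s hs
  have hrise := hmono (left_mem_Icc.2 hh.le) (Ioo_subset_Icc_self hs) hs.1.le
  refine ⟨by simp [γ, slabHeight, mul_comm], ?_⟩
  simp only [zero_smul, add_zero, mul_zero, sub_zero] at hrise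
  exact le_sub_iff_add_le.1 hrise

end Slab

section Zones

variable {f : EuclideanSpace ℝ (Fin 3) → ℝ} {a b δ m M t : ℝ}

open scoped Pointwise in
theorem slabGrad_comp_add_single (f : EuclideanSpace ℝ (Fin 3) → ℝ) (t : ℝ)
    (x : EuclideanSpace ℝ (Fin 3)) :
    slabGrad (fun y => f (y + EuclideanSpace.single 0 t)) x =
      slabGrad f (x + EuclideanSpace.single 0 t) := by
  have hslab : (EuclideanSpace.single 0 t : EuclideanSpace ℝ (Fin 3)) +ᵥ slab = slab := by
    ext y
    rw [mem_vadd_set_iff_neg_vadd_mem, vadd_eq_add, add_comm,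
      ← add_single_zero_mem_slab_iff (t := t), neg_add_cancel_right]
  simp only [slabGrad, gradientWithin, fderivWithin_comp_add_right, hslab]

/-- On the window `[a, b] × [-1,1]²` the gradient of `f` has norm at least `δ` and `f` takes values
in `[m, M]`. -/
def IsSteepZone (f : EuclideanSpace ℝ (Fin 3) → ℝ) (a b δ m M : ℝ) : Prop :=
  ∀ y ∈ slabWindow a b, δ ≤ ‖slabGrad f y‖ ∧ f y ∈ Icc m M

theorem isSteepZone_iff_of_dense (hf : ContDiffOn ℝ 1 f slab) (hab : a < b)
    {D : Set (EuclideanSpace ℝ (Fin 3))} (hD : Dense D) :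
    IsSteepZone f a b δ m M ↔
      ∀ y ∈ interior (slabWindow a b) ∩ D, δ ≤ ‖slabGrad f y‖ ∧ f y ∈ Icc m M := by
  refine ⟨fun h y hy => h y (interior_subset hy.1), fun h y hy => ?_⟩
  have hcont : ContinuousOn (fun y => (‖slabGrad f y‖, f y)) (slabWindow a b) :=
    ((continuousOn_slabGrad hf).norm.prodMk hf.continuousOn).mono inter_subset_left
  have hclosed := hcont.preimage_isClosed_of_isClosed isCompact_slabWindow.isClosed
    ((isClosed_Ici (a := δ)).prod (isClosed_Icc (a := m) (b := M)))
  have hdense : slabWindow a b ⊆ closure (interior (slabWindow a b) ∩ D) :=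
    subset_closure.trans ((convex_slabWindow.closure_interior_eq_closure_of_nonempty_interior
      (nonempty_interior_slabWindow hab)).symm.subset.trans
        (closure_minimal (hD.open_subset_closure_inter isOpen_interior) isClosed_closure))
  exact (closure_minimal (t := slabWindow a b ∩ _) (fun z hz => ⟨interior_subset hz.1, h z hz⟩)
    hclosed (hdense hy)).2

theorem IsSteepZone.of_comp_add_single
    (h : IsSteepZone (fun y => f (y + EuclideanSpace.single 0 t)) a b δ m M) :
    IsSteepZone f (a + t) (b + t) δ m M := fun y hy => by
  have hy' : y - EuclideanSpace.single 0 t ∈ slabWindow a b :=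
    ⟨add_single_zero_mem_slab_iff.1 ((sub_add_cancel y _).symm ▸ hy.1), by
      simpa [sub_le_iff_le_add, le_sub_iff_add_le] using hy.2⟩
  simpa only [slabGrad_comp_add_single, sub_add_cancel] using h _ hy'

/-- A steep zone over `[a, b]`, together with a point `p` at which `f` is higher than in the
zone. -/
def IsPeakedZone (f : EuclideanSpace ℝ (Fin 3) → ℝ) (a b δ m M : ℝ) (p : slab) : Prop :=
  a < b ∧ 0 < δ ∧ IsSteepZone f a b δ m M ∧ M < f p

/-- Some slice `{q} × [-1,1]²` of the slab contains no critical point of `f`. -/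
def HasRegularSlice (f : EuclideanSpace ℝ (Fin 3) → ℝ) : Prop :=
  ∃ q, ∀ y ∈ slab, y 0 = q → slabGrad f y ≠ 0

theorem HasRegularSlice.comp_add_single (h : HasRegularSlice f) (t : ℝ) :
    HasRegularSlice fun y => f (y + EuclideanSpace.single 0 t) := by
  obtain ⟨q, hq⟩ := h
  refine ⟨q - t, fun y hy hyq => ?_⟩
  rw [slabGrad_comp_add_single]
  exact hq _ (add_single_zero_mem_slab_iff.2 hy) (by simp [hyq])

theorem hasRegularSlice_comp_add_single_iff :
    HasRegularSlice (fun y => f (y + EuclideanSpace.single 0 t)) ↔ HasRegularSlice f :=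
  ⟨fun h => by simpa [add_assoc, PiLp.single_neg] using h.comp_add_single (-t),
    fun h => h.comp_add_single t⟩

theorem IsPeakedZone.hasRegularSlice {p : slab}
    (h : IsPeakedZone f a b δ m M p) : HasRegularSlice f := by
  obtain ⟨hab, hδ, hzone, -⟩ := h
  refine ⟨a, fun y hy hya => norm_pos_iff.1 (hδ.trans_le (hzone y ⟨hy, ?_⟩).1)⟩
  exact ⟨hya.ge, hya.le.trans hab.le⟩

theorem isCompact_preimage_slabHeight_singleton (q : ℝ) : IsCompact (slabHeight ⁻¹' {q}) :=
  isProperMap_slabHeight.isCompact_preimage isCompact_singleton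

theorem exists_forall_slice_lt (hf : ContDiffOn ℝ 1 f slab) (hin : GradPointsInward f) {q : ℝ}
    (hq : ∀ y : slab, slabHeight y = q → slabGrad f y ≠ 0) :
    ∃ p : slab, ∀ y : slab, slabHeight y = q → f y < f p := by
  obtain ⟨x, rfl, hx⟩ := (isCompact_preimage_slabHeight_singleton q).exists_isMaxOn
    (surjective_slabHeight q) hf.continuousOn.domRestrict.continuousOn
  obtain ⟨κ, hκ, hκx⟩ := exists_between (norm_pos_iff.2 (hq x rfl))
  obtain ⟨p, hp⟩ := (hin.isSteepAlong hf hκx).exists_gt hκ hx.localize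
  exact ⟨p, fun y hy => (hx hy).trans_lt hp⟩

theorem exists_isSteepZone (hf : ContDiffOn ℝ 1 f slab) {q : ℝ} {δ m M : ℝ}
    (h : ∀ y : slab, slabHeight y = q → δ < ‖slabGrad f y‖ ∧ f y ∈ Ioo m M) :
    ∃ a b : ℚ, a < b ∧ IsSteepZone f a b δ m M := by
  have hgrad : Continuous fun z : slab => slabGrad f z :=
    (continuousOn_slabGrad hf).domRestrict
  have hcont : Continuous fun z : slab => f z := hf.continuousOn.domRestrict
  have hnear := isProperMap_slabHeight.isClosedMap.eventually_nhds_fiber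
    (p := fun y : slab => δ < ‖slabGrad f y‖ ∧ f y ∈ Ioo m M) q fun y hy =>
      (hgrad.norm.continuousAt.eventually_const_lt (h y hy).1).and
        (hcont.continuousAt.eventually_mem (isOpen_Ioo.mem_nhds (h y hy).2))
  obtain ⟨l, u, ⟨hl, hu⟩, hlu⟩ := mem_nhds_iff_exists_Ioo_subset.1 hnear
  obtain ⟨a, hla, haq⟩ := exists_rat_btwn hl
  obtain ⟨b, hqb, hbu⟩ := exists_rat_btwn hu
  refine ⟨a, b, by exact_mod_cast haq.trans hqb, fun y hy => ?_⟩
  obtain ⟨hδ, hm⟩ := hlu ⟨hla.trans_le hy.2.1, hy.2.2.trans_lt hbu⟩ ⟨y, hy.1⟩ rfl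
  exact ⟨hδ.le, Ioo_subset_Icc_self hm⟩

theorem HasRegularSlice.exists_isPeakedZone (h : HasRegularSlice f) (hf : ContDiffOn ℝ 1 f slab)
    (hin : GradPointsInward f) :
    ∃ (a b δ m M : ℚ) (k : ℕ), IsPeakedZone f a b δ m M (TopologicalSpace.denseSeq slab k) := by
  obtain ⟨q, hq⟩ := h
  have hgrad : ContinuousOn (fun y : slab => ‖slabGrad f y‖) (slabHeight ⁻¹' {q}) :=
    (continuousOn_slabGrad hf).norm.domRestrict.continuousOn
  have hcont : Continuous fun z : slab => f z := hf.continuousOn.domRestrict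
  have hK := isCompact_preimage_slabHeight_singleton q
  obtain ⟨x, hx, hxmin⟩ := hK.exists_isMinOn (surjective_slabHeight q) hgrad
  obtain ⟨y, -, hymin⟩ := hK.exists_isMinOn (surjective_slabHeight q) hcont.continuousOn
  obtain ⟨z, hz, hzmax⟩ := hK.exists_isMaxOn (surjective_slabHeight q) hcont.continuousOn
  obtain ⟨p, hp⟩ := exists_forall_slice_lt hf hin fun y hy => hq y y.2 hy
  obtain ⟨δ, hδ0, hδ⟩ := exists_rat_btwn (norm_pos_iff.2 (hq x x.2 hx))
  obtain ⟨m, hm⟩ := exists_rat_lt (f y)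
  obtain ⟨M, hzM, hMp⟩ := exists_rat_btwn (hp z hz)
  obtain ⟨k, hMk⟩ := (TopologicalSpace.denseRange_denseSeq slab).exists_mem_open
    (isOpen_Ioi.preimage hcont) ⟨p, hMp⟩
  obtain ⟨a, b, hab, hzone⟩ := exists_isSteepZone hf (δ := δ) (m := m) (M := M) fun w hw =>
    ⟨hδ.trans_le (hxmin hw), hm.trans_le (hymin hw), (hzmax hw).trans_lt hzM⟩
  exact ⟨a, b, δ, m, M, k, by exact_mod_cast hab, hδ0, hzone, hMk⟩

theorem exists_seq_of_frequently {p : ℝ → Prop} (h : ∃ᶠ n : ℕ in atTop, p n) (R T : ℝ) :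
    ∃ ν : ℕ → ℝ, R < ν 0 ∧ (∀ k, ν k + T ≤ ν (k + 1)) ∧ ∀ k, p (ν k) := by
  obtain ⟨φ, hφ, hp⟩ := extraction_of_frequently_atTop h
  obtain ⟨d, hd⟩ := exists_nat_ge T
  obtain ⟨n, hn⟩ := exists_nat_gt R
  refine ⟨fun k => φ (n + d * k), hn.trans_le (Nat.cast_le.2 hφ.le_apply), fun k => ?_,
    fun k => hp _⟩
  have hstep : φ (n + d * k) + d ≤ φ (n + d * (k + 1)) := by
    simpa only [mul_add_one, add_comm, add_left_comm] using hφ.add_le_nat d (n + d * k)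
  calc (φ (n + d * k) : ℝ) + T ≤ φ (n + d * k) + d := by gcongr
    _ ≤ φ (n + d * (k + 1)) := by exact_mod_cast hstep

theorem exists_zones_and_peaks {p : slab} (h : ∃ᶠ n : ℕ in atTop,
      IsPeakedZone (fun y => f (y + EuclideanSpace.single 0 (n : ℝ))) a b δ m M p) (R : ℝ) :
    ∃ (α : ℕ → ℝ) (z : ℕ → slab), R < α 0 ∧ (∀ k, α k + (b - a) ≤ α (k + 1)) ∧
      (∀ k, IsSteepZone f (α k) (α k + (b - a)) δ m M) ∧
      ∀ k, slabHeight (z k) ∈ Icc (α k) (α (k + 1)) ∧ M < f (z k) := by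
  obtain ⟨_, hab, -⟩ := h.exists
  obtain ⟨ν, hν₀, hν, hp⟩ := exists_seq_of_frequently (p := fun t =>
    IsPeakedZone (fun y => f (y + EuclideanSpace.single 0 t)) a b δ m M p) h (R - a)
    (|slabHeight p - a| + (b - a))
  have hgap := fun k => hν (2 * k)
  have hgap' : ∀ k, ν (2 * k + 1) + (|slabHeight p - a| + (b - a)) ≤ ν (2 * (k + 1)) :=
    fun k => hν (2 * k + 1)
  have habs := abs_nonneg (slabHeight p - a)
  refine ⟨fun k => a + ν (2 * k), fun k => ⟨_, add_single_zero_mem_slab_iff.2 p.2⟩,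
    by linarith [hν₀], fun k => by linarith [hgap k, hgap' k], fun k => ?_,
    fun k => ⟨?_, (hp (2 * k + 1)).2.2.2⟩⟩
  · convert (hp (2 * k)).2.2.1.of_comp_add_single using 1
    ring
  · have hheight : slabHeight ⟨(p : EuclideanSpace ℝ (Fin 3)) +
        EuclideanSpace.single 0 (ν (2 * k + 1)), add_single_zero_mem_slab_iff.2 p.2⟩ =
        slabHeight p + ν (2 * k + 1) := by simp [slabHeight]
    rw [hheight]
    constructor <;>
      linarith [hgap k, hgap' k, neg_abs_le (slabHeight p - a), le_abs_self (slabHeight p - a)]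

theorem infinite_of_forall_exists_gt_apply {ι : Type*} {A : Set (EuclideanSpace ℝ ι)} {i : ι}
    (h : ∀ R : ℝ, ∃ x ∈ A, R < x i) : A.Infinite := by
  refine .of_image (fun x => x i) (infinite_of_not_bddAbove ?_)
  rintro ⟨R, hR⟩
  obtain ⟨x, hx, hxR⟩ := h R
  exact (hR ⟨x, hx, rfl⟩).not_gt hxR

theorem infinite_localMaxPts {p : slab} (hf : ContDiffOn ℝ 1 f slab) (hin : GradPointsInward f)
    (h : ∃ᶠ n : ℕ in atTop,
      IsPeakedZone (fun y => f (y + EuclideanSpace.single 0 (n : ℝ))) a b δ m M p) :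
    (localMaxPts f).Infinite := by
  refine infinite_of_forall_exists_gt_apply (i := 0) fun R => ?_
  obtain ⟨_, hab, -⟩ := h.exists
  obtain ⟨α, z, hR, -, hzone, hz⟩ := exists_zones_and_peaks h R
  have hfiber : ∀ k (y : slab), slabHeight y = α k → f y ≤ M := fun k y hy =>
    (hzone k y ⟨y.2, hy.ge, hy.le.trans (by linarith)⟩).2.2
  obtain ⟨x, hx, hmax⟩ := exists_isLocalMax_of_fibers_le hf.continuousOn.domRestrict
    isProperMap_slabHeight (hz 0).1 (hz 0).2 (hfiber 0) (hfiber 1)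
  have hmax' := isLocalMax_slab_iff.1 hmax
  exact ⟨x, ⟨⟨x.2, hin.slabGrad_eq_zero_of_isLocalMaxOn (hf.differentiableOn one_ne_zero x x.2) x.2
    hmax'⟩, hmax'⟩, hR.trans hx.1⟩

theorem infinite_saddlePts_union_localMinPts {p : slab} (hf : ContDiffOn ℝ 1 f slab)
    (hin : GradPointsInward f) (h : ∃ᶠ n : ℕ in atTop,
      IsPeakedZone (fun y => f (y + EuclideanSpace.single 0 (n : ℝ))) a b δ m M p) :
    (saddlePts f ∪ localMinPts f).Infinite := by
  refine infinite_of_forall_exists_gt_apply (i := 0) fun R => ?_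
  obtain ⟨_, hab, hδ, -⟩ := h.exists
  obtain ⟨α, z, hR, hα, hzone, hz⟩ := exists_zones_and_peaks h R
  obtain ⟨x, hx, hmax, hreg⟩ := exists_not_isLocalMax_and_not_isRegularFromAbove
    (f := fun y : slab => f y) hf.continuousOn.domRestrict isProperMap_slabHeight
    surjective_slabHeight (fun _ _ => isPreconnected_preimage_slabHeight_Icc) (half_pos hδ)
    (sub_pos.2 hab) hα (fun k y hy => ⟨(hzone k y ⟨y.2, hy⟩).2,
      hin.isSteepAlong hf ((half_lt_self hδ).trans_le (hzone k y ⟨y.2, hy⟩).1)⟩)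
    (fun k => (hz k).1) fun k => (hz k).2
  have hcrit : (x : EuclideanSpace ℝ (Fin 3)) ∈ critPts f :=
    ⟨x.2, not_not.1 fun hne => hreg (hin.isRegularFromAbove hf hne)⟩
  rw [isLocalMax_slab_iff] at hmax
  refine ⟨x, ?_, hR.trans_le hx⟩
  by_cases hmin : IsLocalMinOn f slab x
  exacts [.inr ⟨hcrit, hmin⟩, .inl ⟨hcrit, hmax, hmin⟩]

theorem hasContinuumOfCritPts_of_not_hasRegularSlice (h : ¬HasRegularSlice f) :
    HasContinuumOfCritPts f := by
  have hslice : ∀ q, ∃ y : critPts f, (y : EuclideanSpace ℝ (Fin 3)) 0 = q := by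
    simpa [HasRegularSlice, critPts, and_assoc, and_comm, and_left_comm] using h
  refine le_antisymm ?_ (Cardinal.mk_real ▸ Cardinal.mk_le_of_surjective hslice)
  calc Cardinal.mk (critPts f) ≤ Cardinal.mk (EuclideanSpace ℝ (Fin 3)) := Cardinal.mk_set_le _
    _ = Cardinal.mk (Fin 3 → ℝ) := Cardinal.mk_congr (WithLp.equiv 2 _)
    _ = Cardinal.continuum ^ ((3 : ℕ) : Cardinal) := by simp [Cardinal.mk_real]
    _ = Cardinal.continuum := Cardinal.power_nat_eq Cardinal.aleph0_le_continuum (by simp)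

theorem HasContinuumOfCritPts.infinite (h : HasContinuumOfCritPts f) : (critPts f).Infinite := by
  rw [← Set.infinite_coe_iff, Cardinal.infinite_iff]
  exact Cardinal.aleph0_le_continuum.trans_eq h.symm

end Zones

section RandomField

variable {Ω : Type*} [MeasurableSpace Ω] {μ : Measure Ω}

theorem aemeasurable_fderivWithin {𝕜 E G : Type*} [NontriviallyNormedField 𝕜]
    [NormedAddCommGroup E] [NormedSpace 𝕜 E] [NormedAddCommGroup G] [NormedSpace 𝕜 G]
    [MeasurableSpace G] [BorelSpace G] [SecondCountableTopology G] {F : Ω → E → G} {S : Set E}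
    {x v : E} (hF : ∀ y ∈ S, AEMeasurable (fun ω => F ω y) μ)
    (hd : ∀ᵐ ω ∂μ, DifferentiableWithinAt 𝕜 (F ω) S x) (hx : x ∈ S)
    (hv : v ∈ tangentConeAt 𝕜 S x) : AEMeasurable (fun ω => fderivWithin 𝕜 (F ω) S x v) μ := by
  obtain ⟨c, d, hd₀, hdS, hcd⟩ := mem_tangentConeAt_iff_exists_seq.1 hv
  obtain ⟨n, hn⟩ := eventually_atTop.1 hdS
  have hshift := tendsto_add_atTop_nat n
  refine aemeasurable_of_tendsto_metrizable_ae'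
    (f := fun k ω => c (k + n) • (F ω (x + d (k + n)) - F ω x))
    (fun k => ((hF _ (hn _ le_add_self)).sub (hF x hx)).const_smul _) ?_
  filter_upwards [hd] with ω hω
  exact (hω.hasFDerivWithinAt.lim hd₀ hdS hcd).comp hshift

variable {F : Ω → EuclideanSpace ℝ (Fin 3) → ℝ} {x : EuclideanSpace ℝ (Fin 3)} {a b δ m M : ℝ}

theorem aemeasurable_norm_slabGrad (hF : ∀ y ∈ slab, AEMeasurable (fun ω => F ω y) μ)
    (hd : ∀ᵐ ω ∂μ, DifferentiableWithinAt ℝ (F ω) slab x) (hx : x ∈ interior slab) :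
    AEMeasurable (fun ω => ‖slabGrad (F ω) x‖) μ := by
  have hcoord : ∀ i, AEMeasurable (fun ω => slabGrad (F ω) x i) μ := fun i => by
    simp only [slabGrad_apply]
    refine aemeasurable_fderivWithin hF hd (interior_subset hx) ?_
    rw [tangentConeAt_of_mem_nhds (mem_interior_iff_mem_nhds.1 hx)]
    trivial
  simp only [EuclideanSpace.norm_eq]
  fun_prop

theorem nullMeasurableSet_isSteepZone (hF : ∀ y ∈ slab, AEMeasurable (fun ω => F ω y) μ)
    (hC1 : ∀ᵐ ω ∂μ, ContDiffOn ℝ 1 (F ω) slab) (hab : a < b) :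
    NullMeasurableSet {ω | IsSteepZone (F ω) a b δ m M} μ := by
  obtain ⟨D, hDc, hD⟩ := TopologicalSpace.exists_countable_dense (EuclideanSpace ℝ (Fin 3))
  have hpoint : ∀ y ∈ interior (slabWindow a b) ∩ D,
      NullMeasurableSet {ω | δ ≤ ‖slabGrad (F ω) y‖ ∧ F ω y ∈ Icc m M} μ := fun y hy => by
    have hyint : y ∈ interior slab := interior_mono inter_subset_left hy.1
    have hyslab := interior_subset hyint
    have hgrad := aemeasurable_norm_slabGrad hF
      (hC1.mono fun ω hω => hω.differentiableOn one_ne_zero y hyslab) hyint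
    exact (hgrad.nullMeasurable measurableSet_Ici).inter
      ((hF y hyslab).nullMeasurable measurableSet_Icc)
  refine (NullMeasurableSet.biInter (hDc.mono inter_subset_right) hpoint).congr ?_
  filter_upwards [hC1] with ω hω
  exact propext (mem_iInter₂.trans (isSteepZone_iff_of_dense hω hab hD).symm)

theorem nullMeasurableSet_isPeakedZone (hF : ∀ y ∈ slab, AEMeasurable (fun ω => F ω y) μ)
    (hC1 : ∀ᵐ ω ∂μ, ContDiffOn ℝ 1 (F ω) slab) (p : slab) :
    NullMeasurableSet {ω | IsPeakedZone (F ω) a b δ m M p} μ := by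
  by_cases hab : a < b
  · simp only [IsPeakedZone, hab, true_and]
    exact (NullMeasurableSet.const _).inter ((nullMeasurableSet_isSteepZone hF hC1 hab).inter
      ((hF p p.2).nullMeasurable measurableSet_Ioi))
  · simp [IsPeakedZone, hab]

theorem nullMeasurableSet_hasRegularSlice (hF : ∀ y ∈ slab, AEMeasurable (fun ω => F ω y) μ)
    (hC1 : ∀ᵐ ω ∂μ, ContDiffOn ℝ 1 (F ω) slab) (hin : ∀ᵐ ω ∂μ, GradPointsInward (F ω)) :
    NullMeasurableSet {ω | HasRegularSlice (F ω)} μ := by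
  have hzones : NullMeasurableSet {ω | ∃ (a b δ m M : ℚ) (k : ℕ),
      IsPeakedZone (F ω) a b δ m M (TopologicalSpace.denseSeq slab k)} μ := by
    simp only [Set.ofPred_exists]
    exact .iUnion fun _ => .iUnion fun _ => .iUnion fun _ => .iUnion fun _ => .iUnion fun _ =>
      .iUnion fun _ => nullMeasurableSet_isPeakedZone hF hC1 _
  refine hzones.congr ?_
  filter_upwards [hC1, hin] with ω hω hωin
  exact propext ⟨fun ⟨_, _, _, _, _, _, h⟩ => h.hasRegularSlice,
    fun h => h.exists_isPeakedZone hω hωin⟩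

end RandomField

section Ergodic

theorem measurable_section {Ω : Type*} [MeasurableSpace Ω] {K : Ω → ℝ → ℝ → ℝ} {s t : Set ℝ}
    (hK : Measurable fun z : Ω × s × t => K z.1 z.2.1 z.2.2) {p₁ p₂ : ℝ} (h₁ : p₁ ∈ s)
    (h₂ : p₂ ∈ t) : Measurable fun ω => K ω p₁ p₂ := by
  have hpair : Measurable fun ω : Ω => (ω, (⟨p₁, h₁⟩ : s), (⟨p₂, h₂⟩ : t)) :=
    measurable_id.prodMk measurable_const
  exact hK.comp hpair

variable {Ω : Type*} [TopologicalSpace Ω] {τ : Flow ℝ Ω} {Kbar : Ω → ℝ → ℝ → ℝ}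

theorem ae_flow_flow_mem_iff {B : Set Ω} (s : ℝ) (ω : Ω) :
    (∀ᵐ t : ℝ, τ t (τ s ω) ∈ B) ↔ ∀ᵐ t : ℝ, τ t ω ∈ B := by
  have h := (measurableEmbedding_addRight s).ae_map_iff (μ := volume) (p := fun t => τ t ω ∈ B)
  simpa only [map_add_right_eq_self, τ.map_add] using h.symm

theorem stationaryFun_flow (t : ℝ) (ω : Ω) : stationaryFun τ Kbar (τ t ω) =
    fun x => stationaryFun τ Kbar ω (x + EuclideanSpace.single 0 t) := by
  funext x
  simp [stationaryFun, τ.map_add]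

variable [MeasurableSpace Ω] {P : Measure Ω}

theorem ae_frequently_flow_mem [IsFiniteMeasure P] (hτ : MeasurePreserving (τ 1) P P) {A : Set Ω}
    (hA : NullMeasurableSet A P) : ∀ᵐ ω ∂P, ω ∈ A → ∃ᶠ n : ℕ in atTop, τ (n : ℝ) ω ∈ A := by
  have hiter : ∀ (n : ℕ) (ω : Ω), (τ 1)^[n] ω = τ (n : ℝ) ω := fun n ω => by
    induction n with
    | zero => simp
    | succ n ih => rw [Function.iterate_succ_apply', ih, ← τ.map_add, Nat.cast_succ, add_comm]
  simpa only [hiter] using hτ.conservative.ae_mem_imp_frequently_image_mem hA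

theorem aemeasurable_stationaryFun (hτ : ∀ t, MeasurePreserving (τ t) P P)
    (hK : ∀ p₁ ∈ Icc (-1 : ℝ) 1, ∀ p₂ ∈ Icc (-1 : ℝ) 1, AEMeasurable (fun ω => Kbar ω p₁ p₂) P)
    {x : EuclideanSpace ℝ (Fin 3)} (hx : x ∈ slab) :
    AEMeasurable (fun ω => stationaryFun τ Kbar ω x) P :=
  (hK _ hx.1 _ hx.2).comp_quasiMeasurePreserving (hτ (x 0)).quasiMeasurePreserving

theorem ae_infinite_of_hasRegularSlice [IsFiniteMeasure P] (hτ : ∀ t, MeasurePreserving (τ t) P P)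
    (hK : ∀ p₁ ∈ Icc (-1 : ℝ) 1, ∀ p₂ ∈ Icc (-1 : ℝ) 1, AEMeasurable (fun ω => Kbar ω p₁ p₂) P)
    (hC1 : ∀ᵐ ω ∂P, ContDiffOn ℝ 1 (stationaryFun τ Kbar ω) slab)
    (hin : ∀ᵐ ω ∂P, GradPointsInward (stationaryFun τ Kbar ω)) :
    ∀ᵐ ω ∂P, HasRegularSlice (stationaryFun τ Kbar ω) →
      (localMaxPts (stationaryFun τ Kbar ω)).Infinite ∧
        (saddlePts (stationaryFun τ Kbar ω) ∪
          localMinPts (stationaryFun τ Kbar ω)).Infinite := by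
  have hrec : ∀ᵐ ω ∂P, ∀ (a b δ m M : ℚ) (k : ℕ),
      IsPeakedZone (stationaryFun τ Kbar ω) a b δ m M (TopologicalSpace.denseSeq slab k) →
      ∃ᶠ n : ℕ in atTop, IsPeakedZone (stationaryFun τ Kbar (τ (n : ℝ) ω)) a b δ m M
        (TopologicalSpace.denseSeq slab k) := by
    simp only [ae_all_iff]
    exact fun a b δ m M k => ae_frequently_flow_mem (hτ 1) (nullMeasurableSet_isPeakedZone
      (fun x hx => aemeasurable_stationaryFun hτ hK hx) hC1 _)
  filter_upwards [hC1, hin, hrec] with ω hω hωin hωrec hreg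
  obtain ⟨a, b, δ, m, M, k, hzone⟩ := hreg.exists_isPeakedZone hω hωin
  have hfreq := hωrec a b δ m M k hzone
  simp only [stationaryFun_flow] at hfreq
  exact ⟨infinite_localMaxPts hω hωin hfreq, infinite_saddlePts_union_localMinPts hω hωin hfreq⟩

theorem IsInvariantErgodicProb.prob_eq_one_or_eq_zero (hP : IsInvariantErgodicProb τ P) {A : Set Ω}
    (hA : MeasurableSet A) (hinv : ∀ t, τ t ⁻¹' A = A) : P A = 1 ∨ P A = 0 :=
  hP.ergodic A hA fun t => (τ.image_eq_preimage_symm t A).trans (hinv (-t))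

variable [BorelSpace Ω]

theorem IsInvariantErgodicProb.measurePreserving (hP : IsInvariantErgodicProb τ P) (t : ℝ) :
    MeasurePreserving (τ t) P P := by
  have hm : Measurable (τ t) := (τ.continuous_toFun t).measurable
  refine ⟨hm, Measure.ext fun B hB => ?_⟩
  rw [Measure.map_apply hm hB, ← hP.preserving (-t) B hB, τ.image_eq_preimage_symm, neg_neg]

theorem measurableSet_ae_flow_mem {B : Set Ω} (hB : MeasurableSet B) :
    MeasurableSet {ω | ∀ᵐ t : ℝ, τ t ω ∈ B} := by
  have hflow : Continuous fun z : Ω × ℝ => τ z.2 z.1 := by fun_prop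
  exact measurableSet_eq_fun (measurable_measure_prodMk_left (ν := (volume : Measure ℝ))
    (hflow.measurable hB.compl)) measurable_const

theorem ae_ae_flow_mem_iff [SFinite P] {B : Set Ω} (hB : MeasurableSet B)
    (hinv : ∀ t, τ t ⁻¹' B =ᵐ[P] B) : ∀ᵐ ω ∂P, (∀ᵐ t : ℝ, τ t ω ∈ B) ↔ ω ∈ B := by
  have hflow : Continuous fun z : Ω × ℝ => τ z.2 z.1 := by fun_prop
  have horbit : ∀ᵐ ω ∂P, ∀ᵐ t : ℝ, τ t ω ∈ B ↔ ω ∈ B :=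
    (Measure.ae_ae_comm ((hflow.measurable hB).iff (measurable_fst hB))).2
      (.of_forall fun t => (hinv t).mem_iff)
  filter_upwards [horbit] with ω hω
  rw [eventually_congr hω, eventually_const]

theorem ae_mem_or_ae_notMem_of_invariant [IsProbabilityMeasure P]
    (hτ : ∀ t, MeasurePreserving (τ t) P P)
    (herg : ∀ A, MeasurableSet A → (∀ t, τ t ⁻¹' A = A) → P A = 1 ∨ P A = 0) {A : Set Ω}
    (hA : NullMeasurableSet A P) (hinv : ∀ t, τ t ⁻¹' A =ᵐ[P] A) :
    (∀ᵐ ω ∂P, ω ∈ A) ∨ ∀ᵐ ω ∂P, ω ∉ A := by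
  obtain ⟨B, hB, hAB⟩ := hA
  have hBinv : ∀ t, τ t ⁻¹' B =ᵐ[P] B := fun t =>
    ((hτ t).quasiMeasurePreserving.preimage_ae_eq hAB.symm).trans ((hinv t).trans hAB)
  have horbit : ∀ᵐ ω ∂P, (∀ᵐ t : ℝ, τ t ω ∈ B) ↔ ω ∈ A := by
    filter_upwards [ae_ae_flow_mem_iff hB hBinv, hAB.mem_iff] with ω hω hωA
    rw [hω, hωA]
  -- `A` is invariant only up to null sets, `{ω | ∀ᵐ t, τ t ω ∈ B}` is exactly invariant.
  have hmeas := measurableSet_ae_flow_mem (τ := τ) hB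
  refine (herg _ hmeas fun s => Set.ext (ae_flow_flow_mem_iff s)).imp (fun h1 => ?_) fun h0 => ?_
  · exact (eventually_congr horbit).1 ((mem_ae_iff_prob_eq_one hmeas).2 h1)
  · exact (eventually_congr (horbit.mono fun ω hω => not_congr hω)).1
      (measure_eq_zero_iff_ae_notMem.1 h0)

end Ergodic

theorem mainTheorem5_general {Ω : Type*} [TopologicalSpace Ω] [MeasurableSpace Ω] [BorelSpace Ω]
    (τ : Flow ℝ Ω) (P : Measure Ω) [IsProbabilityMeasure P]
    (hτ : ∀ t, MeasurePreserving (τ t) P P)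
    (herg : ∀ A, MeasurableSet A → (∀ t, τ t ⁻¹' A = A) → P A = 1 ∨ P A = 0)
    (Kbar : Ω → ℝ → ℝ → ℝ)
    (hK : ∀ p₁ ∈ Icc (-1 : ℝ) 1, ∀ p₂ ∈ Icc (-1 : ℝ) 1, AEMeasurable (fun ω => Kbar ω p₁ p₂) P)
    (hC1 : ∀ᵐ ω ∂P, ContDiffOn ℝ 1 (stationaryFun τ Kbar ω) slab)
    (hin : ∀ᵐ ω ∂P, GradPointsInward (stationaryFun τ Kbar ω)) :
    (∀ᵐ ω ∂P, (critPts (stationaryFun τ Kbar ω)).Infinite) ∧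
    ((∀ᵐ ω ∂P, HasContinuumOfCritPts (stationaryFun τ Kbar ω)) ∨
      (∀ᵐ ω ∂P, (localMaxPts (stationaryFun τ Kbar ω)).Infinite ∧
        (saddlePts (stationaryFun τ Kbar ω) ∪
          localMinPts (stationaryFun τ Kbar ω)).Infinite)) := by
  have hmeas := nullMeasurableSet_hasRegularSlice
    (fun x hx => aemeasurable_stationaryFun hτ hK hx) hC1 hin
  have hinv : ∀ t, τ t ⁻¹' {ω | HasRegularSlice (stationaryFun τ Kbar ω)} =
      {ω | HasRegularSlice (stationaryFun τ Kbar ω)} := fun t => by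
    ext ω
    simp only [mem_preimage, mem_ofPred_eq, stationaryFun_flow, hasRegularSlice_comp_add_single_iff]
  rcases ae_mem_or_ae_notMem_of_invariant hτ herg hmeas fun t => (hinv t).eventuallyEq
    with hreg | hsing
  · have hinf := (ae_infinite_of_hasRegularSlice hτ hK hC1 hin).mp
      (hreg.mono fun ω hω himp => himp hω)
    exact ⟨hinf.mono fun ω h => h.1.mono fun x hx => hx.1, .inr hinf⟩
  · have hcont := hsing.mono fun ω => hasContinuumOfCritPts_of_not_hasRegularSlice
    exact ⟨hcont.mono fun ω h => h.infinite, .inl hcont⟩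

theorem mainTheorem5 {Ω : Type*} [MetricSpace Ω] [TopologicalSpace.SeparableSpace Ω]
    [MeasurableSpace Ω] [BorelSpace Ω] (τ : Flow ℝ Ω) (P : Measure Ω)
    (hP : IsInvariantErgodicProb τ P)
    (Kbar : Ω → ℝ → ℝ → ℝ)
    (hmeas : Measurable fun z : Ω × Icc (-1 : ℝ) 1 × Icc (-1 : ℝ) 1 => Kbar z.1 z.2.1 z.2.2)
    (hC1 : ∀ᵐ ω ∂P, ContDiffOn ℝ 1 (stationaryFun τ Kbar ω) slab)
    (hin : ∀ᵐ ω ∂P, GradPointsInward (stationaryFun τ Kbar ω)) :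
    (∀ᵐ ω ∂P, (critPts (stationaryFun τ Kbar ω)).Infinite) ∧
    ((∀ᵐ ω ∂P, HasContinuumOfCritPts (stationaryFun τ Kbar ω)) ∨
      (∀ᵐ ω ∂P, (localMaxPts (stationaryFun τ Kbar ω)).Infinite ∧
        (saddlePts (stationaryFun τ Kbar ω) ∪
          localMinPts (stationaryFun τ Kbar ω)).Infinite)) := by
  have := hP.prob
  exact mainTheorem5_general τ P hP.measurePreserving (fun _ => hP.prob_eq_one_or_eq_zero) Kbar
    (fun p₁ h₁ p₂ h₂ => (measurable_section hmeas h₁ h₂).aemeasurable) hC1 hin
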